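/- Let $d\ge 0$ be an integer and $|\cdot|$ the Euclidean norm on $\mathbb Z^d$. Let $K=(K_{x,y})_{x,y\in\mathbb Z^d}$ be a Hermitian kernel, $K_{y,x}=\overline{K_{x,y}}$, of short range: $\sup_x\sum_y |K_{x,y}|e^{\nu|x-y|}<\infty$ for some $\nu>0$. (This includes translation-invariant hopping $K_{x,y}=k(x-y)$ with exponentially summable $k$, and nearest-neighbour hopping $K_{x,y}=e^{-i\mathcal A_{x,y}}\delta_{|x-y|,1}$ in a magnetic field.) Let $U:\mathbb Z^d\to\mathbb R$ be a background potential (for instance a periodic one), $\lambda\in\mathbb R$, and $(V_x)_{x\in\mathbb Z^d}$ real random variables on a probability space with expectation $\mathbb E$ (for instance independent and identically distributed ones). Let $H=K+U+\lambda V$ be the random self-adjoint operator on $\ell^2(\mathbb Z^d)$, $(H\psi)(x)=\sum_yK_{x,y}\psi(y)+(U_x+\lambda V_x)\psi(x)$, with domain $\{\psi\in\ell^2: H\psi\in\ell^2\}$, and for non-real $z$ let $G(x,y;z)=\langle x|(H-z)^{-1}|y\rangle$. Let $E_F\in\mathbb R$, and assume that the fractional-moment bound holds at $E_F$: there are $0<s<1$,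 $C<\infty$ and $\mu>0$ such that $$\mathbb E\big(|G(x,y;E_F+i\eta)|^s\big)\le C^s e^{-s\mu|x-y|}\qquad\text{for all real }\eta\ne0\text{ and all }x,y\in\mathbb Z^d .$$ For $T>0$ let $\theta_T(u)=(1+e^{u/T})^{-1}$, and let $P_{\le E_F}$ be the spectral projection of $H$ on $(-\infty,E_F]$. Then there are constants $C<\infty$ and $0<\xi<\infty$, independent of $T$, $x$ and $y$, such that $$\mathbb E\big(|\langle x|\theta_T(H-E_F)|y\rangle|\big)\le C e^{-|x-y|/\xi}\qquad\text{for all }T>0\text{ and all }x,y\in\mathbb Z^d,$$ and also (the case $T=0$) $$\mathbb E\big(|\langle x|P_{\le E_F}|y\rangle|\big)\le C e^{-|x-y|/\xi}\qquad\text{for all }x,y\in\mathbb Z^d .$$ -/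

import Mathlib

noncomputable section
open scoped InnerProductSpace ComplexConjugate CompactlySupported

namespace LinearPMap

section Abstract

variable {E : Type*} [NormedAddCommGroup E] [InnerProductSpace ℂ E]

/-- The linear map `u ↦ A u - z u` on the domain of `A`. -/
def shift (A : E →ₗ.[ℂ] E) (z : ℂ) : A.domain →ₗ[ℂ] E := A.toFun - z • A.domain.subtype

theorem shift_apply (A : E →ₗ.[ℂ] E) (z : ℂ) (u : A.domain) :
    A.shift z u = A u - z • (u : E) := rfl

variable [CompleteSpace E]

theorem inner_apply_of_isSelfAdjoint {A : E →ₗ.[ℂ] E} (hA : IsSelfAdjoint A) (u v : A.domain) :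
    ⟪A u, (v : E)⟫_ℂ = ⟪(u : E), A v⟫_ℂ := by
  have h := LinearPMap.adjoint_isFormalAdjoint hA.dense_domain
  rw [LinearPMap.isSelfAdjoint_def.mp hA] at h
  exact h u v

theorem norm_le_shift {A : E →ₗ.[ℂ] E} (hA : IsSelfAdjoint A) (z : ℂ) (u : A.domain) :
    |z.im| * ‖(u : E)‖ ≤ ‖A.shift z u‖ := by
  have h1 : (⟪(u : E), A u⟫_ℂ).im = 0 := by
    have h := inner_apply_of_isSelfAdjoint hA u u
    have h2 : conj ⟪(u : E), A u⟫_ℂ = ⟪(u : E), A u⟫_ℂ := by rw [inner_conj_symm, h]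
    exact Complex.conj_eq_iff_im.mp h2
  have h3 : (⟪(u : E), A.shift z u⟫_ℂ).im = -z.im * ‖(u : E)‖ ^ 2 := by
    rw [shift_apply, inner_sub_right, inner_smul_right, inner_self_eq_norm_sq_to_K, Complex.sub_im,
      h1]
    simp [← Complex.ofReal_pow]
  have h4 : |z.im| * ‖(u : E)‖ ^ 2 ≤ ‖(u : E)‖ * ‖A.shift z u‖ := by
    calc |z.im| * ‖(u : E)‖ ^ 2 = |(⟪(u : E), A.shift z u⟫_ℂ).im| := by
          rw [h3, abs_mul, abs_neg, abs_of_nonneg (sq_nonneg ‖(u : E)‖)]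
      _ ≤ ‖⟪(u : E), A.shift z u⟫_ℂ‖ := Complex.abs_im_le_norm _
      _ ≤ _ := norm_inner_le_norm _ _
  rcases eq_or_lt_of_le (norm_nonneg (u : E)) with h0 | h0
  · rw [← h0]; simp
  · nlinarith

theorem shift_bijective {A : E →ₗ.[ℂ] E} (hA : IsSelfAdjoint A) {z : ℂ} (hz : z.im ≠ 0) :
    Function.Bijective (A.shift z) := by
  have hz' : 0 < |z.im| := abs_pos.mpr hz
  refine ⟨?_, ?_⟩
  · rw [← LinearMap.ker_eq_bot, LinearMap.ker_eq_bot']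
    intro u hu
    have h := norm_le_shift hA z u
    rw [hu, norm_zero] at h
    have h0 : ‖(u : E)‖ = 0 := le_antisymm (by nlinarith) (norm_nonneg _)
    exact Subtype.ext (norm_eq_zero.mp h0)
  · rw [← LinearMap.range_eq_top]
    have hclosed : _root_.IsClosed ((LinearMap.range (A.shift z) : Submodule ℂ E) : Set E) := by
      refine IsSeqClosed.isClosed ?_
      intro y y₀ hy hlim
      choose u hu using hy
      have hcau : CauchySeq (fun n => ((u n : A.domain) : E)) := by
        rw [Metric.cauchySeq_iff']
        intro ε hε
        obtain ⟨N, hN⟩ := Metric.cauchySeq_iff'.mp hlim.cauchySeq (|z.im| * ε) (by positivity)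
        refine ⟨N, fun n hn => ?_⟩
        have h := norm_le_shift hA z (u n - u N)
        rw [_root_.map_sub, hu, hu] at h
        have h2 := hN n hn
        rw [dist_eq_norm] at h2 ⊢
        have h3 : |z.im| * ‖(u n : E) - (u N : E)‖ < |z.im| * ε := lt_of_le_of_lt h h2
        exact lt_of_mul_lt_mul_left h3 hz'.le
      obtain ⟨x, hx⟩ := cauchySeq_tendsto_of_complete hcau
      have hAu : Filter.Tendsto (fun n => A (u n)) Filter.atTop (nhds (y₀ + z • x)) := by
        have h := hlim.add (hx.const_smul z)
        refine h.congr fun n => ?_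
        rw [← hu n, shift_apply]; abel
      have hmem : (x, y₀ + z • x) ∈ A.graph := by
        have hc : _root_.IsClosed (A.graph : Set (E × E)) := hA.isClosed
        exact hc.mem_of_tendsto (hx.prodMk_nhds hAu)
          (Filter.Eventually.of_forall fun n => A.mem_graph (u n))
      obtain ⟨v, hv1, hv2⟩ := A.mem_graph_iff.mp hmem
      refine ⟨v, ?_⟩
      rw [shift_apply]
      simp only at hv1 hv2
      rw [hv1, hv2]; abel
    have horth : (LinearMap.range (A.shift z))ᗮ = ⊥ := by
      rw [Submodule.eq_bot_iff]
      intro φ hφ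
      have h1 : ∀ u : A.domain, ⟪conj z • φ, (u : E)⟫_ℂ = ⟪φ, A u⟫_ℂ := by
        intro u
        have h := Submodule.inner_left_of_mem_orthogonal (LinearMap.mem_range_self (A.shift z) u) hφ
        rw [shift_apply, inner_sub_right, inner_smul_right, sub_eq_zero] at h
        rw [inner_smul_left, h]; simp
      have hdom : φ ∈ A.adjoint.domain := LinearPMap.mem_adjoint_domain_of_exists φ ⟨_, h1⟩
      have happ := LinearPMap.adjoint_apply_eq hA.dense_domain ⟨φ, hdom⟩ h1
      have hgr : (φ, conj z • φ) ∈ A.adjoint.graph := by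
        have h := A.adjoint.mem_graph ⟨φ, hdom⟩
        rwa [happ] at h
      rw [LinearPMap.isSelfAdjoint_def.mp hA] at hgr
      obtain ⟨v, hv1, hv2⟩ := A.mem_graph_iff.mp hgr
      simp only at hv1 hv2
      have h := norm_le_shift hA (conj z) v
      rw [shift_apply, hv2, hv1, sub_self, norm_zero, Complex.conj_im, abs_neg] at h
      exact norm_eq_zero.mp (le_antisymm (by nlinarith) (norm_nonneg _))
    have : CompleteSpace (LinearMap.range (A.shift z)) := hclosed.completeSpace_coe
    exact Submodule.orthogonal_eq_bot_iff.mp horth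

/-- The resolvent `(A - z)⁻¹` of a self-adjoint operator at a non-real `z` (and `0` for real `z`),
as a bounded operator. -/
def resolvent (A : E →ₗ.[ℂ] E) (hA : IsSelfAdjoint A) (z : ℂ) : E →L[ℂ] E :=
  open Classical in
  if hz : z.im ≠ 0 then
    LinearMap.mkContinuous
      (A.domain.subtype ∘ₗ (LinearEquiv.ofBijective (A.shift z) (shift_bijective hA hz)).symm)
      |z.im|⁻¹ (fun φ => by
        have h := norm_le_shift hA z
          ((LinearEquiv.ofBijective (A.shift z) (shift_bijective hA hz)).symm φ)
        have h2 := (LinearEquiv.ofBijective (A.shift z) (shift_bijective hA hz)).apply_symm_apply φ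
        rw [LinearEquiv.ofBijective_apply] at h2
        rw [h2] at h
        rw [inv_mul_eq_div, le_div_iff₀ (abs_pos.mpr hz), mul_comm]
        exact h)
  else 0

/-- `resolvent` is a right inverse of `A - z`. -/
theorem exists_shift_resolvent {A : E →ₗ.[ℂ] E} (hA : IsSelfAdjoint A) {z : ℂ} (hz : z.im ≠ 0)
    (φ : E) : ∃ u : A.domain, (u : E) = A.resolvent hA z φ ∧ A.shift z u = φ := by
  refine ⟨(LinearEquiv.ofBijective (A.shift z) (shift_bijective hA hz)).symm φ, ?_, ?_⟩
  · rw [resolvent, dif_pos hz]; rfl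
  · exact (LinearEquiv.ofBijective (A.shift z) (shift_bijective hA hz)).apply_symm_apply φ

/-- `resolvent` is a left inverse of `A - z`. -/
theorem resolvent_shift {A : E →ₗ.[ℂ] E} (hA : IsSelfAdjoint A) {z : ℂ} (hz : z.im ≠ 0)
    (u : A.domain) : A.resolvent hA z (A.shift z u) = u := by
  obtain ⟨v, hv1, hv2⟩ := exists_shift_resolvent hA hz (A.shift z u)
  rw [← hv1, (shift_bijective hA hz).1 hv2]

theorem star_resolvent {A : E →ₗ.[ℂ] E} (hA : IsSelfAdjoint A) {z : ℂ} (hz : z.im ≠ 0) :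
    star (A.resolvent hA z) = A.resolvent hA (conj z) := by
  have hz' : (conj z).im ≠ 0 := by simpa using hz
  rw [ContinuousLinearMap.star_eq_adjoint, eq_comm, ContinuousLinearMap.eq_adjoint_iff]
  intro a b
  obtain ⟨u, hu1, hu2⟩ := exists_shift_resolvent hA hz' a
  obtain ⟨v, hv1, hv2⟩ := exists_shift_resolvent hA hz b
  rw [← hu1, ← hv1, ← hu2, ← hv2, shift_apply, shift_apply, inner_sub_left, inner_sub_right,
    inner_smul_left, inner_smul_right, inner_apply_of_isSelfAdjoint hA]
  simp

theorem resolvent_sub_resolvent {A : E →ₗ.[ℂ] E} (hA : IsSelfAdjoint A) {z w : ℂ}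
    (hz : z.im ≠ 0) (hw : w.im ≠ 0) :
    A.resolvent hA z - A.resolvent hA w = (z - w) • (A.resolvent hA z * A.resolvent hA w) := by
  ext φ
  obtain ⟨v, hv1, hv2⟩ := exists_shift_resolvent hA hw φ
  have h : φ = A.shift z v + (z - w) • (v : E) := by
    rw [← hv2, shift_apply, shift_apply, sub_smul]; abel
  have h2 : A.resolvent hA z φ = v + (z - w) • A.resolvent hA z v := by
    conv_lhs => rw [h]
    rw [_root_.map_add, _root_.map_smul, resolvent_shift hA hz]
  simp only [_root_.sub_apply, _root_.smul_apply,
    mul_apply_eq_comp]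
  rw [← hv1, h2]; abel

/-- The Cayley transform `(A - i) (A + i)⁻¹ = 1 - 2 i (A + i)⁻¹`. -/
def cayley (A : E →ₗ.[ℂ] E) (hA : IsSelfAdjoint A) : E →L[ℂ] E :=
  1 - (2 * Complex.I) • A.resolvent hA (-Complex.I)

theorem isStarNormal_cayley (A : E →ₗ.[ℂ] E) (hA : IsSelfAdjoint A) :
    IsStarNormal (A.cayley hA) := by
  have h1 : (-Complex.I).im ≠ 0 := by simp
  have h2 : (Complex.I).im ≠ 0 := by simp
  have hstar : star (A.cayley hA) = 1 + (2 * Complex.I) • A.resolvent hA Complex.I := by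
    rw [cayley, star_sub, star_one, star_smul, star_resolvent hA h1]
    simp
  have hc : Commute (A.resolvent hA Complex.I) (A.resolvent hA (-Complex.I)) := by
    have e1 := resolvent_sub_resolvent hA h2 h1
    have e2 := resolvent_sub_resolvent hA h1 h2
    have e3 : (Complex.I - -Complex.I) • (A.resolvent hA Complex.I * A.resolvent hA (-Complex.I)) =
        (Complex.I - -Complex.I) •
          (A.resolvent hA (-Complex.I) * A.resolvent hA Complex.I) := by
      rw [← e1, ← neg_sub, e2, ← neg_smul, neg_sub]
    exact smul_right_injective _ (by simp [← two_mul]) e3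
  refine ⟨?_⟩
  rw [hstar, cayley]
  exact ((Commute.one_left _).add_left ((((Commute.one_right _).sub_right
    (hc.smul_right _))).smul_left _))

/-- The positive functional `g ↦ ⟨ψ, g(U) ψ⟩` on real continuous functions on the spectrum of the
Cayley transform `U` of `A`. -/
def cayleyFunctional (A : E →ₗ.[ℂ] E) (hA : IsSelfAdjoint A) (ψ : E) :
    C_c(spectrum ℂ (A.cayley hA), ℝ) →ₚ[ℝ] ℝ :=
  PositiveLinearMap.mk₀
    { toFun := fun g => (⟪ψ, cfcHom (A.isStarNormal_cayley hA)
        (⟨fun u => (g u : ℂ), by fun_prop⟩ : C(spectrum ℂ (A.cayley hA), ℂ)) ψ⟫_ℂ).re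
      map_add' := fun g h => by
        rw [← Complex.add_re, ← inner_add_right, ← _root_.add_apply, ← _root_.map_add]
        congr 5
        ext u
        simp
      map_smul' := fun c g => by
        have : (⟨fun u => ((c • g) u : ℂ), by fun_prop⟩ : C(spectrum ℂ (A.cayley hA), ℂ)) =
            (c : ℂ) • ⟨fun u => (g u : ℂ), by fun_prop⟩ := by
          ext u
          simp
        rw [this, _root_.map_smul, _root_.smul_apply, inner_smul_right]
        simp }
    (fun g hg => by
      have hsq : (⟨fun u => (g u : ℂ), by fun_prop⟩ : C(spectrum ℂ (A.cayley hA), ℂ)) =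
          star ⟨fun u => (Real.sqrt (g u) : ℂ), by fun_prop⟩ *
            ⟨fun u => (Real.sqrt (g u) : ℂ), by fun_prop⟩ := by
        ext u
        simp [← Complex.ofReal_mul, Real.mul_self_sqrt (hg u)]
      change 0 ≤ (⟪ψ, cfcHom (A.isStarNormal_cayley hA)
        (⟨fun u => (g u : ℂ), by fun_prop⟩ : C(spectrum ℂ (A.cayley hA), ℂ)) ψ⟫_ℂ).re
      rw [hsq, _root_.map_mul, StarHomClass.map_star, mul_apply_eq_comp,
        ContinuousLinearMap.star_eq_adjoint, ContinuousLinearMap.adjoint_inner_right]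
      exact inner_self_nonneg (𝕜 := ℂ))

/-- The spectral measure `B ↦ ⟨ψ, 1_B(A) ψ⟩` of the self-adjoint operator `A` at `ψ`: the measure on
the spectrum of the Cayley transform `U` that represents `g ↦ ⟨ψ, g(U) ψ⟩`, carried to the real line
by the inverse `u ↦ i (1 + u) / (1 - u)` of `t ↦ (t - i) / (t + i)`. -/
def spectralMeasure (A : E →ₗ.[ℂ] E) (hA : IsSelfAdjoint A) (ψ : E) : MeasureTheory.Measure ℝ :=
  (RealRMK.rieszMeasure (A.cayleyFunctional hA ψ)).map
    (fun u : spectrum ℂ (A.cayley hA) => (Complex.I * (1 + (u : ℂ)) / (1 - (u : ℂ))).re)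

/-- The matrix element `⟨φ, f(A) ψ⟩` of the Borel functional calculus, for a bounded Borel
function `f`, obtained from `⟨χ, f(A) χ⟩ = ∫ f dμ_χ` by polarization. -/
def borelForm (A : E →ₗ.[ℂ] E) (hA : IsSelfAdjoint A) (f : ℝ → ℂ) (φ ψ : E) : ℂ :=
  4⁻¹ * ((∫ t, f t ∂A.spectralMeasure hA (φ + ψ)) - (∫ t, f t ∂A.spectralMeasure hA (φ - ψ))
    - Complex.I * (∫ t, f t ∂A.spectralMeasure hA (φ + Complex.I • ψ))
    + Complex.I * (∫ t, f t ∂A.spectralMeasure hA (φ - Complex.I • ψ)))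

end Abstract
end LinearPMap

/-! ### The lattice Hamiltonian -/

/-- The lattice `ℤ^d`. -/
abbrev Site (d : ℕ) : Type := Fin d → ℤ

/-- The Hilbert space `ℓ²(ℤ^d)`. -/
abbrev LatticeSpace (d : ℕ) : Type := lp (fun _ : Site d => ℂ) 2

/-- The Euclidean distance `|x - y|` on `ℤ^d`. -/
def latticeDist {d : ℕ} (x y : Site d) : ℝ := Real.sqrt (∑ i, ((x i : ℝ) - (y i : ℝ)) ^ 2)

/-- The basis vector `|x⟩` of `ℓ²(ℤ^d)`. -/
def siteKet {d : ℕ} (x : Site d) : LatticeSpace d := lp.single 2 x (1 : ℂ)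

/-- Hermitian hopping kernels of short range: for some `ν > 0`, the sums
`∑_y |K(x,y)| e^{ν |x - y|}` are bounded uniformly in `x`. -/
structure IsShortRangeHopping {d : ℕ} (K : Site d → Site d → ℂ) : Prop where
  hermitian : ∀ x y, K y x = conj (K x y)
  shortRange : ∃ ν : ℝ, 0 < ν ∧ ∃ B : ℝ, ∀ x,
    Summable (fun y => ‖K x y‖ * Real.exp (ν * latticeDist x y)) ∧
      ∑' y, ‖K x y‖ * Real.exp (ν * latticeDist x y) ≤ B

namespace IsShortRangeHopping

variable {d : ℕ} {K : Site d → Site d → ℂ}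

theorem exists_bound (hK : IsShortRangeHopping K) :
    ∃ B : ℝ, ∀ x, Summable (fun y => ‖K x y‖) ∧ ∑' y, ‖K x y‖ ≤ B := by
  obtain ⟨ν, hν, B, hB⟩ := hK.shortRange
  refine ⟨B, fun x => ?_⟩
  have hle : ∀ y, ‖K x y‖ ≤ ‖K x y‖ * Real.exp (ν * latticeDist x y) := fun y =>
    le_mul_of_one_le_right (norm_nonneg _)
      (Real.one_le_exp (mul_nonneg hν.le (Real.sqrt_nonneg _)))
  have hs : Summable (fun y => ‖K x y‖) :=
    Summable.of_nonneg_of_le (fun _ => norm_nonneg _) hle (hB x).1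
  exact ⟨hs, (hs.tsum_le_tsum hle (hB x).1).trans (hB x).2⟩

theorem norm_symm (hK : IsShortRangeHopping K) (x y : Site d) : ‖K y x‖ = ‖K x y‖ := by
  rw [hK.hermitian x y, RCLike.norm_conj]

theorem summable_row (hK : IsShortRangeHopping K) (ψ : LatticeSpace d) (x : Site d) :
    Summable (fun y => K x y * ψ y) := by
  obtain ⟨B, hB⟩ := hK.exists_bound
  refine Summable.of_norm_bounded ((hB x).1.mul_right ‖ψ‖) fun y => ?_
  rw [norm_mul]
  exact mul_le_mul_of_nonneg_left (lp.norm_apply_le_norm two_ne_zero ψ y) (norm_nonneg _)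

theorem summable_norm_sq (ψ : LatticeSpace d) : Summable (fun x => ‖ψ x‖ ^ 2) := by
  have h := (lp.memℓp ψ).summable (by simp)
  simpa using h

/-- Schur's test. -/
theorem summable_prod (hK : IsShortRangeHopping K) (φ ψ : LatticeSpace d) :
    Summable (fun p : Site d × Site d => ‖K p.1 p.2‖ * ‖φ p.2‖ * ‖ψ p.1‖) := by
  obtain ⟨B, hB⟩ := hK.exists_bound
  have key : ∀ χ : LatticeSpace d,
      Summable (fun p : Site d × Site d => ‖K p.1 p.2‖ * ‖χ p.1‖ ^ 2) := by
    intro χ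
    rw [summable_prod_of_nonneg (fun p => mul_nonneg (norm_nonneg _) (sq_nonneg _))]
    have h1 : ∀ x, Summable (fun y => ‖K x y‖ * ‖χ x‖ ^ 2) := fun x =>
      (hB x).1.mul_right (‖χ x‖ ^ 2)
    have h2 : ∀ x, ∑' y, ‖K x y‖ * ‖χ x‖ ^ 2 ≤ B * ‖χ x‖ ^ 2 := fun x => by
      rw [tsum_mul_right]
      exact mul_le_mul_of_nonneg_right (hB x).2 (sq_nonneg _)
    exact ⟨h1, Summable.of_nonneg_of_le
      (fun x => tsum_nonneg fun y => mul_nonneg (norm_nonneg _) (sq_nonneg _)) h2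
      ((summable_norm_sq χ).mul_left B)⟩
  have h1 := key ψ
  have h2 : Summable (fun p : Site d × Site d => ‖K p.1 p.2‖ * ‖φ p.2‖ ^ 2) := by
    have h := (key φ).prod_symm
    refine h.congr fun p => ?_
    simp [hK.norm_symm p.1 p.2]
  refine Summable.of_nonneg_of_le (fun p => by positivity) (fun p => ?_) (h1.add h2)
  have h3 : ‖φ p.2‖ * ‖ψ p.1‖ ≤ ‖ψ p.1‖ ^ 2 + ‖φ p.2‖ ^ 2 := by
    nlinarith [sq_nonneg (‖φ p.2‖ - ‖ψ p.1‖), sq_nonneg ‖φ p.2‖, sq_nonneg ‖ψ p.1‖]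
  rw [mul_assoc, ← mul_add]
  exact mul_le_mul_of_nonneg_left h3 (norm_nonneg _)

end IsShortRangeHopping

/-- The formal action `(H ψ)(x) = ∑_y K(x,y) ψ(y) + v(x) ψ(x)`. -/
def hamiltonianAction {d : ℕ} (K : Site d → Site d → ℂ) (v : Site d → ℝ)
    (ψ : Site d → ℂ) (x : Site d) : ℂ :=
  (∑' y, K x y * ψ y) + (v x : ℂ) * ψ x

theorem hamiltonianAction_add {d : ℕ} {K : Site d → Site d → ℂ}
    (hK : IsShortRangeHopping K) (v : Site d → ℝ) (φ ψ : LatticeSpace d) :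
    hamiltonianAction K v (φ + ψ : LatticeSpace d) =
      hamiltonianAction K v φ + hamiltonianAction K v ψ := by
  funext x
  simp only [hamiltonianAction, Pi.add_apply, lp.coeFn_add, mul_add]
  rw [(hK.summable_row φ x).tsum_add (hK.summable_row ψ x)]
  ring

theorem hamiltonianAction_smul {d : ℕ} {K : Site d → Site d → ℂ}
    (v : Site d → ℝ) (c : ℂ) (ψ : LatticeSpace d) :
    hamiltonianAction K v (c • ψ : LatticeSpace d) = c • hamiltonianAction K v ψ := by
  funext x
  simp only [hamiltonianAction, Pi.smul_apply, lp.coeFn_smul, smul_eq_mul, mul_left_comm _ c]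
  rw [tsum_mul_left, mul_add]

/-- The self-adjoint operator on `ℓ²(ℤ^d)` with matrix elements `K(x,y) + v(x) δ_{x,y}`, on its
natural domain of all `ψ ∈ ℓ²` with `H ψ ∈ ℓ²`. -/
def hamiltonian {d : ℕ} (K : Site d → Site d → ℂ) (hK : IsShortRangeHopping K)
    (v : Site d → ℝ) : LatticeSpace d →ₗ.[ℂ] LatticeSpace d where
  domain :=
    { carrier := {ψ | Memℓp (E := fun _ : Site d => ℂ) (hamiltonianAction K v ψ) 2}
      add_mem' := fun {φ ψ} hφ hψ => by
        rw [Set.mem_ofPred_eq, hamiltonianAction_add hK]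
        exact Memℓp.add hφ hψ
      zero_mem' := by
        have h : hamiltonianAction K v (0 : LatticeSpace d) = 0 := by
          funext x; simp [hamiltonianAction]
        rw [Set.mem_ofPred_eq, h]
        exact zero_memℓp
      smul_mem' := fun c ψ hψ => by
        rw [Set.mem_ofPred_eq, hamiltonianAction_smul]
        exact Memℓp.const_smul hψ c }
  toFun :=
    { toFun := fun ψ => ⟨hamiltonianAction K v (ψ : LatticeSpace d), ψ.2⟩
      map_add' := fun φ ψ => lp.ext (hamiltonianAction_add hK v φ ψ)
      map_smul' := fun c ψ => lp.ext (hamiltonianAction_smul v c ψ) }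

section SelfAdjoint

variable {d : ℕ} {K : Site d → Site d → ℂ} (hK : IsShortRangeHopping K) (v : Site d → ℝ)

theorem hamiltonian_apply (ψ : (hamiltonian K hK v).domain) (x : Site d) :
    (hamiltonian K hK v ψ : LatticeSpace d) x = hamiltonianAction K v (ψ : LatticeSpace d) x := rfl

theorem mem_hamiltonian_domain (ψ : LatticeSpace d) : ψ ∈ (hamiltonian K hK v).domain ↔
    Memℓp (E := fun _ : Site d => ℂ) (hamiltonianAction K v ψ) 2 := Iff.rfl

theorem hamiltonianAction_siteKet (x y : Site d) :
    hamiltonianAction K v (siteKet x) y = K y x + v x * siteKet x y := by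
  have h : ∀ z, z ≠ x → (siteKet x : LatticeSpace d) z = 0 := fun z hz =>
    lp.single_apply_ne (E := fun _ : Site d => ℂ) 2 x (1 : ℂ) hz
  have h1 : (siteKet x : LatticeSpace d) x = 1 := lp.single_apply_self (E := fun _ : Site d => ℂ) 2 x (1 : ℂ)
  rw [hamiltonianAction, tsum_eq_single x (fun z hz => by rw [h z hz, mul_zero]), h1, mul_one]
  by_cases hyx : y = x
  · rw [hyx]
  · rw [h y hyx]; simp

theorem siteKet_mem_domain (x : Site d) : siteKet x ∈ (hamiltonian K hK v).domain := by
  obtain ⟨B, hB⟩ := hK.exists_bound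
  have h1 : Memℓp (E := fun _ : Site d => ℂ) (fun y => K y x) 2 := by
    refine Memℓp.of_exponent_ge (q := 1) ?_ one_le_two
    refine memℓp_gen ?_
    simpa [hK.norm_symm] using (hB x).1
  have h2 : Memℓp (E := fun _ : Site d => ℂ) ((v x : ℂ) • ⇑(siteKet x)) 2 :=
    Memℓp.const_smul (lp.memℓp (siteKet x)) _
  have h3 : hamiltonianAction K v (siteKet x) = (fun y => K y x) + (v x : ℂ) • ⇑(siteKet x) := by
    funext y
    rw [hamiltonianAction_siteKet]; rfl
  rw [mem_hamiltonian_domain, h3]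
  exact h1.add h2

theorem inner_siteKet (x : Site d) (ψ : LatticeSpace d) : ⟪siteKet x, ψ⟫_ℂ = ψ x := by
  rw [siteKet, lp.inner_single_left]; simp

theorem dense_hamiltonian_domain :
    Dense ((hamiltonian K hK v).domain : Set (LatticeSpace d)) := by
  rw [Submodule.dense_iff_topologicalClosure_eq_top, Submodule.topologicalClosure_eq_top_iff,
    Submodule.eq_bot_iff]
  intro ψ hψ
  ext x
  rw [← inner_siteKet]
  exact Submodule.inner_right_of_mem_orthogonal (siteKet_mem_domain hK v x) hψ

theorem hamiltonian_isFormalAdjoint :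
    (hamiltonian K hK v).IsFormalAdjoint (hamiltonian K hK v) := by
  intro φ ψ
  set f : LatticeSpace d := ↑φ with hf
  set g : LatticeSpace d := ↑ψ with hg
  have hs := hK.summable_prod f g
  have hF : Summable (fun p : Site d × Site d => conj (K p.1 p.2 * f p.2) * g p.1) := by
    refine Summable.of_norm (hs.congr fun p => ?_)
    rw [norm_mul, RCLike.norm_conj, norm_mul]
  have hrow : ∀ x, ∑' y, conj (K x y * f y) * g x = conj (∑' y, K x y * f y) * g x := by
    intro x
    rw [tsum_mul_right, ← Complex.conj_tsum]
  have hcol : ∀ y, ∑' x, conj (K x y * f y) * g x = conj (f y) * ∑' x, K y x * g x := by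
    intro y
    rw [← tsum_mul_left]
    refine tsum_congr fun x => ?_
    rw [map_mul, hK.hermitian x y]; ring
  have h1 : HasSum (fun x => conj (∑' y, K x y * f y) * g x)
      (∑' p : Site d × Site d, conj (K p.1 p.2 * f p.2) * g p.1) := by
    have h := hF.hasSum.prod_fiberwise (fun x => (hF.prod_factor x).hasSum)
    simpa only [hrow] using h
  have h2 : HasSum (fun y => conj (f y) * ∑' x, K y x * g x)
      (∑' p : Site d × Site d, conj (K p.1 p.2 * f p.2) * g p.1) := by
    have hF' := hF.prod_symm
    have h := hF'.hasSum.prod_fiberwise (fun y => (hF'.prod_factor y).hasSum)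
    rw [← (Equiv.prodComm (Site d) (Site d)).tsum_eq
      (fun p : Site d × Site d => conj (K p.1 p.2 * f p.2) * g p.1)]
    simpa only [Equiv.prodComm_apply, Prod.swap, hcol] using h
  have h3 := lp.hasSum_inner (𝕜 := ℂ) (hamiltonian K hK v φ) g
  have h4 := lp.hasSum_inner (𝕜 := ℂ) f (hamiltonian K hK v ψ)
  have h6 := h1.sub h2
  have hcongr : (fun x => ⟪(hamiltonian K hK v φ : LatticeSpace d) x, g x⟫_ℂ -
      ⟪f x, (hamiltonian K hK v ψ : LatticeSpace d) x⟫_ℂ) =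
      fun x => conj (∑' y, K x y * f y) * g x - conj (f x) * ∑' y, K x y * g y := by
    funext x
    rw [hamiltonian_apply, hamiltonian_apply, hamiltonianAction, hamiltonianAction]
    simp only [RCLike.inner_apply, map_add, map_mul, Complex.conj_ofReal, f, g]
    ring
  have h5 := h3.sub h4
  rw [hcongr] at h5
  have h7 := h5.unique h6
  rw [sub_self, sub_eq_zero] at h7
  exact h7

theorem isSelfAdjoint_hamiltonian : IsSelfAdjoint (hamiltonian K hK v) := by
  have hd := dense_hamiltonian_domain hK v
  have hle := (hamiltonian_isFormalAdjoint hK v).le_adjoint hd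
  have hact : ∀ ψ : (hamiltonian K hK v).adjoint.domain,
      ((hamiltonian K hK v).adjoint ψ : Site d → ℂ) =
        hamiltonianAction K v (ψ : LatticeSpace d) := by
    intro ψ
    funext x
    have h := LinearPMap.adjoint_isFormalAdjoint hd ψ ⟨siteKet x, siteKet_mem_domain hK v x⟩
    have h' := congrArg conj h
    rw [inner_conj_symm, inner_conj_symm, inner_siteKet] at h'
    rw [h', lp.inner_eq_tsum]
    set f : LatticeSpace d := ↑ψ with hf
    have hterm : ∀ y, ⟪(hamiltonian K hK v ⟨siteKet x, siteKet_mem_domain hK v x⟩ :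
        LatticeSpace d) y, f y⟫_ℂ = K x y * f y + v x * ⟪(siteKet x : LatticeSpace d) y, f y⟫_ℂ := by
      intro y
      rw [hamiltonian_apply, hamiltonianAction_siteKet, hK.hermitian x y]
      simp only [RCLike.inner_apply, map_add, map_mul, Complex.conj_ofReal, Complex.conj_conj]
      ring
    have hz : ∀ y, y ≠ x →
        (v x : ℂ) * ⟪(siteKet x : LatticeSpace d) y, f y⟫_ℂ = 0 := fun y hy => by
      have h0 : (siteKet x : LatticeSpace d) y = 0 := lp.single_apply_ne (E := fun _ : Site d => ℂ) 2 x (1 : ℂ) hy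
      rw [h0, inner_zero_left, mul_zero]
    have h1 : (siteKet x : LatticeSpace d) x = 1 := lp.single_apply_self (E := fun _ : Site d => ℂ) 2 x (1 : ℂ)
    have hs : Summable fun y => (v x : ℂ) * ⟪(siteKet x : LatticeSpace d) y, f y⟫_ℂ :=
      (hasSum_single x hz).summable
    simp only [hterm]
    rw [(hK.summable_row f x).tsum_add hs, tsum_eq_single x hz, h1, hamiltonianAction]
    simp
  rw [LinearPMap.isSelfAdjoint_def]
  have hge : (hamiltonian K hK v).adjoint ≤ hamiltonian K hK v := by
    constructor
    · intro ψ hψ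
      rw [mem_hamiltonian_domain, ← hact ⟨ψ, hψ⟩]
      exact lp.memℓp _
    · intro φ ψ hφψ
      refine lp.ext ?_
      rw [hact φ, hφψ]
      rfl
  exact le_antisymm hge hle

end SelfAdjoint

/-- The Green function `G(x, y; z) = ⟨x| (H - z)⁻¹ |y⟩` of `H = K + v`, for non-real `z`. -/
def greenFunction {d : ℕ} (K : Site d → Site d → ℂ) (hK : IsShortRangeHopping K)
    (v : Site d → ℝ) (z : ℂ) (x y : Site d) : ℂ :=
  ⟪siteKet x, (hamiltonian K hK v).resolvent (isSelfAdjoint_hamiltonian hK v) z (siteKet y)⟫_ℂ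

/-- The matrix element `⟨x| f(H) |y⟩` of a bounded Borel function of `H = K + v`. -/
def functionKernel {d : ℕ} (K : Site d → Site d → ℂ) (hK : IsShortRangeHopping K)
    (v : Site d → ℝ) (f : ℝ → ℂ) (x y : Site d) : ℂ :=
  (hamiltonian K hK v).borelForm (isSelfAdjoint_hamiltonian hK v) f (siteKet x) (siteKet y)

/-- The Fermi distribution `θ_T(u) = (1 + e^{u/T})⁻¹` at temperature `T > 0`. -/
def fermiDistribution (T u : ℝ) : ℝ := (1 + Real.exp (u / T))⁻¹

/-- The matrix element `⟨x| θ_T(H - E_F) |y⟩`. -/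
def fermiKernel {d : ℕ} (K : Site d → Site d → ℂ) (hK : IsShortRangeHopping K)
    (v : Site d → ℝ) (T E_F : ℝ) (x y : Site d) : ℂ :=
  functionKernel K hK v (fun u => (fermiDistribution T (u - E_F) : ℂ)) x y

/-- The matrix element `⟨x| P_{≤ E_F} |y⟩` of the spectral projection of `H` on `(-∞, E_F]`. -/
def fermiProjectionKernel {d : ℕ} (K : Site d → Site d → ℂ) (hK : IsShortRangeHopping K)
    (v : Site d → ℝ) (E_F : ℝ) (x y : Site d) : ℂ :=
  functionKernel K hK v (Set.indicator (Set.Iic E_F) 1) x y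
end

noncomputable section
open scoped InnerProductSpace ComplexConjugate CompactlySupported

/-! ### The Cayley transform, spectral measures and resolvents. -/

namespace LinearPMap

open MeasureTheory Filter Topology

variable {E : Type*} [NormedAddCommGroup E] [InnerProductSpace ℂ E]

/-! The Fermi function has poles only at the Matsubara points `E_F ± i ω_n`, `ω_n = π T (2n+1)`, and
`θ_T(H - E_F) = 1/2 - T ∑_n [G(E_F + i ω_n) + G(E_F - i ω_n)]`. So a matrix element between distinct
sites is a Riemann-type sum of Green functions on the vertical line through `E_F`, which is exactly
where the fractional-moment bound is assumed.

The expectation of each term is controlled in two regimes. Near the real axis, `|G| ≤ 1/|η|` turns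
the fractional moment into a first moment at the price of `|η|^(s-1)`, which is integrable at `0`
(`integral_norm_greenFunction_le`). Far from the axis, a deterministic Combes-Thomas estimate, valid
for every real potential, gives exponential decay with prefactor `O(η^(-2))` off the diagonal
(`norm_greenFunction_le_exp_of_ne`); a prefactor `1/|η|` would make the sum diverge logarithmically.
One decreasing integrable weight dominates both (`fractionalWeight`), and its Matsubara sums,
multiplied by `T`, are bounded uniformly in `T` (`sum_fractionalWeight_matsubara_le`). The diagonal
elements are bounded trivially.

For the projection, `θ_T(u)` tends to the indicator of `u < 0` plus one half at `u = 0`. The missing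
half of the eigenprojection at `E_F` is the limit of `-(i η / 2) (H - E_F - i η)⁻¹`, whose expected
matrix element is `O(η^s)` and vanishes. Thus the bound for `T > 0` passes to `T = 0` with the same
constants.

The remaining work links the functional calculus to resolvents. The spectral measure is defined
through the Cayley transform, so one must show that it integrates `(t - z)⁻¹` to the resolvent
(`integral_inv_sub_spectralMeasure`), in particular that no mass sits at the point `1`, the image of
`t = ∞`. Measurability in the randomness follows from strong resolvent continuity in the potential.
-/

theorem polarization_inner (B : E →L[ℂ] E) (φ ψ : E) :
    4⁻¹ * (⟪φ + ψ, B (φ + ψ)⟫_ℂ - ⟪φ - ψ, B (φ - ψ)⟫_ℂ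
      - Complex.I * ⟪φ + Complex.I • ψ, B (φ + Complex.I • ψ)⟫_ℂ
      + Complex.I * ⟪φ - Complex.I • ψ, B (φ - Complex.I • ψ)⟫_ℂ) = ⟪φ, B ψ⟫_ℂ := by
  simp only [_root_.map_add, _root_.map_sub, _root_.map_smul, inner_add_left, inner_add_right,
    inner_sub_left, inner_sub_right, inner_smul_left, inner_smul_right, Complex.conj_I]
  linear_combination (2⁻¹ * (⟪ψ, B φ⟫_ℂ - ⟪φ, B ψ⟫_ℂ)) * Complex.I_sq

variable [CompleteSpace E]

theorem norm_resolvent_apply_le {A : E →ₗ.[ℂ] E} (hA : IsSelfAdjoint A) {z : ℂ} (hz : z.im ≠ 0)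
    (φ : E) : ‖A.resolvent hA z φ‖ ≤ |z.im|⁻¹ * ‖φ‖ := by
  obtain ⟨u, hu1, hu2⟩ := exists_shift_resolvent hA hz φ
  have h := norm_le_shift hA z u
  rw [hu1, hu2] at h
  rwa [inv_mul_eq_div, le_div_iff₀ (abs_pos.mpr hz), mul_comm]

/-- Expanding `U* U`, the resolvent identity between `i` and `-i` cancels everything but `1`;
normality supplies the other order. Unitarity confines the spectrum to the unit circle, where the
inverse Cayley map is real. -/
theorem cayley_mem_unitary (A : E →ₗ.[ℂ] E) (hA : IsSelfAdjoint A) :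
    A.cayley hA ∈ unitary (E →L[ℂ] E) := by
  have h1 : (-Complex.I).im ≠ 0 := by simp
  have h2 : (Complex.I).im ≠ 0 := by simp
  have hstar : star (A.cayley hA) = 1 + (2 * Complex.I) • A.resolvent hA Complex.I := by
    rw [cayley, star_sub, star_one, star_smul, star_resolvent hA h1]
    simp
  have hI : (2 * Complex.I) * (2 * Complex.I) = -4 := by
    linear_combination 4 * Complex.I_mul_I
  have hleft : star (A.cayley hA) * A.cayley hA = 1 := by
    have e1 := resolvent_sub_resolvent hA h2 h1
    rw [sub_neg_eq_add, ← two_mul] at e1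
    rw [hstar, cayley, add_mul, one_mul, mul_sub, mul_one, smul_mul_smul_comm, sub_add_sub_comm,
      hI, sub_eq_iff_eq_add, add_right_inj]
    calc _ = (2 * Complex.I) •
          (A.resolvent hA Complex.I - A.resolvent hA (-Complex.I)) +
            (2 * Complex.I) • A.resolvent hA (-Complex.I) := by rw [smul_sub]; abel
      _ = _ := by rw [e1, smul_smul, hI]; abel
  rw [Unitary.mem_iff]
  exact ⟨hleft, by rw [← (A.isStarNormal_cayley hA).star_comm_self.eq]; exact hleft⟩

theorem norm_eq_one_of_mem_spectrum_cayley {A : E →ₗ.[ℂ] E} (hA : IsSelfAdjoint A) {u : ℂ}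
    (hu : u ∈ spectrum ℂ (A.cayley hA)) : ‖u‖ = 1 := by
  have := spectrum.subset_circle_of_unitary (𝕜 := ℂ) (A.cayley_mem_unitary hA) hu
  simpa using this

/-- The Riesz measure is only known on real functions, and through a real part. For real `g` the
operator `g(U)` is self-adjoint, so the real part loses nothing; complex `f` are split into real and
imaginary parts. -/
theorem integral_cayleyFunctional {A : E →ₗ.[ℂ] E} (hA : IsSelfAdjoint A) (ψ : E)
    (f : C(spectrum ℂ (A.cayley hA), ℂ)) :
    ∫ u, f u ∂(RealRMK.rieszMeasure (A.cayleyFunctional hA ψ)) =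
      ⟪ψ, cfcHom (A.isStarNormal_cayley hA) f ψ⟫_ℂ := by
  have hreal : ∀ g : C(spectrum ℂ (A.cayley hA), ℝ),
      ((∫ u, g u ∂(RealRMK.rieszMeasure (A.cayleyFunctional hA ψ)) : ℝ) : ℂ) =
        ⟪ψ, cfcHom (A.isStarNormal_cayley hA)
          (⟨fun u => (g u : ℂ), by fun_prop⟩ : C(spectrum ℂ (A.cayley hA), ℂ)) ψ⟫_ℂ := by
    intro g
    have h := RealRMK.integral_rieszMeasure (A.cayleyFunctional hA ψ)
      ⟨g, HasCompactSupport.of_compactSpace _⟩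
    have h' : ∫ u, g u ∂(RealRMK.rieszMeasure (A.cayleyFunctional hA ψ)) =
      (⟪ψ, cfcHom (A.isStarNormal_cayley hA)
        (⟨fun u => (g u : ℂ), by fun_prop⟩ : C(spectrum ℂ (A.cayley hA), ℂ)) ψ⟫_ℂ).re := h
    rw [h']
    apply Complex.conj_eq_iff_re.mp
    rw [inner_conj_symm, ← ContinuousLinearMap.adjoint_inner_right,
      ← ContinuousLinearMap.star_eq_adjoint, ← map_star]
    congr 4
    ext u
    simp
  have hint : Integrable f (RealRMK.rieszMeasure (A.cayleyFunctional hA ψ)) :=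
    f.continuous.integrable_of_hasCompactSupport (HasCompactSupport.of_compactSpace _)
  rw [← integral_re_add_im hint]
  have h1 := hreal ⟨fun u => (f u).re, by fun_prop⟩
  have h2 := hreal ⟨fun u => (f u).im, by fun_prop⟩
  simp only [ContinuousMap.coe_mk] at h1 h2
  change ((∫ u, (f u).re ∂_ : ℝ) : ℂ) + ((∫ u, (f u).im ∂_ : ℝ) : ℂ) * Complex.I = _
  rw [h1, h2, mul_comm, ← inner_smul_right, ← _root_.smul_apply, ← _root_.map_smul,
    ← inner_add_right, ← _root_.add_apply, ← _root_.map_add]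
  congr 4
  ext u
  simp [mul_comm Complex.I]

theorem resolventFunction_denominator_ne_zero {A : E →ₗ.[ℂ] E} (hA : IsSelfAdjoint A) {z : ℂ}
    (hz : z.im ≠ 0) (u : spectrum ℂ (A.cayley hA)) :
    (Complex.I - z) + (Complex.I + z) * (u : ℂ) ≠ 0 := by
  intro h
  have hu := norm_eq_one_of_mem_spectrum_cayley hA u.2
  have h1 : ‖Complex.I - z‖ = ‖Complex.I + z‖ := by
    rw [eq_neg_of_add_eq_zero_left h, norm_neg, norm_mul, hu, mul_one]
  have h2 : ‖Complex.I - z‖ ^ 2 = ‖Complex.I + z‖ ^ 2 := by rw [h1]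
  rw [← Complex.normSq_eq_norm_sq, ← Complex.normSq_eq_norm_sq, Complex.normSq_apply,
    Complex.normSq_apply] at h2
  simp at h2
  exact hz (by linarith)

/-- The function `u ↦ 1 / (t - z)`, `t = i (1 + u) / (1 - u)`, on the spectrum of the Cayley
transform. -/
def cayleyResolventFunction (A : E →ₗ.[ℂ] E) (hA : IsSelfAdjoint A) (z : ℂ) (hz : z.im ≠ 0) :
    C(spectrum ℂ (A.cayley hA), ℂ) where
  toFun u := (1 - u) / ((Complex.I - z) + (Complex.I + z) * u)
  continuous_toFun := Continuous.div (by fun_prop) (by fun_prop) fun u =>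
    resolventFunction_denominator_ne_zero hA hz u

/-- The functional calculus turns the scalar identity into `R ((i - z) + (i + z) U) = 1 - U`.
Applied to `(A + i) v` with `(A - z) v = φ`, and using `U (A + i) v = (A - i) v`, it reads `2i R φ =
2i v`. -/
theorem cfcHom_cayleyResolventFunction {A : E →ₗ.[ℂ] E} (hA : IsSelfAdjoint A) {z : ℂ}
    (hz : z.im ≠ 0) :
    cfcHom (A.isStarNormal_cayley hA) (A.cayleyResolventFunction hA z hz) =
      A.resolvent hA z := by
  have h1 : (-Complex.I).im ≠ 0 := by simp
  have hmul : A.cayleyResolventFunction hA z hz *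
      ((Complex.I - z) • (1 : C(spectrum ℂ (A.cayley hA), ℂ)) + (Complex.I + z) •
        (ContinuousMap.restrict (spectrum ℂ (A.cayley hA)) (.id ℂ))) =
      1 - (ContinuousMap.restrict (spectrum ℂ (A.cayley hA)) (.id ℂ)) := by
    ext u
    have hne := resolventFunction_denominator_ne_zero hA hz u
    simp only [cayleyResolventFunction, ContinuousMap.mul_apply, ContinuousMap.coe_mk,
      ContinuousMap.add_apply, ContinuousMap.smul_apply, ContinuousMap.one_apply,
      ContinuousMap.restrict_apply, ContinuousMap.id_apply, smul_eq_mul, mul_one,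
      ContinuousMap.sub_apply]
    exact div_mul_cancel₀ _ hne
  have hop := congrArg (cfcHom (A.isStarNormal_cayley hA)) hmul
  rw [_root_.map_mul, _root_.map_sub, _root_.map_add, _root_.map_smul, _root_.map_smul,
    _root_.map_one, cfcHom_id] at hop
  ext φ
  obtain ⟨v, hv1, hv2⟩ := exists_shift_resolvent hA hz φ
  have hU : A.cayley hA (A.shift (-Complex.I) v) =
      A.shift (-Complex.I) v - (2 * Complex.I) • (v : E) := by
    rw [cayley, _root_.sub_apply, _root_.smul_apply, resolvent_shift hA h1]; rfl
  have h := congrArg (fun T : E →L[ℂ] E => T (A.shift (-Complex.I) v)) hop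
  simp only [mul_apply_eq_comp, _root_.add_apply, _root_.sub_apply, _root_.smul_apply,
    one_apply_eq_self, hU] at h
  have h2 : (Complex.I - z) • A.shift (-Complex.I) v + (Complex.I + z) •
      (A.shift (-Complex.I) v - (2 * Complex.I) • (v : E)) = (2 * Complex.I) • φ := by
    rw [← hv2, shift_apply, shift_apply]
    module
  rw [h2, sub_sub_cancel, _root_.map_smul] at h
  rw [← hv1]
  exact smul_right_injective E (by simp : (2 * Complex.I) ≠ 0) h

/-- With `η = n + 1`, the operators `-iη (A - iη)⁻¹` are contractions, and on the domain they differ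
from the identity by `(A - iη)⁻¹ A v = O(1/η)`; density of the domain finishes. -/
theorem tendsto_smul_resolvent {A : E →ₗ.[ℂ] E} (hA : IsSelfAdjoint A) (ψ : E) :
    Tendsto (fun n : ℕ => (-((n + 1 : ℝ) * Complex.I)) • A.resolvent hA ((n + 1 : ℝ) * Complex.I) ψ)
      atTop (𝓝 ψ) := by
  have him : ∀ n : ℕ, (((n + 1 : ℝ) : ℂ) * Complex.I).im = n + 1 := fun n => by simp
  have hpos : ∀ n : ℕ, (0 : ℝ) < n + 1 := fun n => by positivity
  have hne : ∀ n : ℕ, (((n + 1 : ℝ) : ℂ) * Complex.I).im ≠ 0 := fun n => by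
    rw [him]; exact (hpos n).ne'
  have hnorm : ∀ n : ℕ, ‖-(((n + 1 : ℝ) : ℂ) * Complex.I)‖ = n + 1 := fun n => by
    rw [norm_neg, norm_mul, Complex.norm_I, mul_one, Complex.norm_real, Real.norm_eq_abs,
      abs_of_pos (hpos n)]
  have hle : ∀ (n : ℕ) (φ : E),
      ‖(-((n + 1 : ℝ) * Complex.I)) • A.resolvent hA ((n + 1 : ℝ) * Complex.I) φ‖ ≤ ‖φ‖ := by
    intro n φ
    have h := norm_resolvent_apply_le hA (hne n) φ
    rw [him, abs_of_pos (hpos n)] at h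
    rw [norm_smul, hnorm]
    calc _ ≤ (n + 1 : ℝ) * ((n + 1 : ℝ)⁻¹ * ‖φ‖) := by gcongr
      _ = ‖φ‖ := by rw [mul_inv_cancel_left₀ (hpos n).ne']
  have hdom : ∀ v : A.domain, Tendsto (fun n : ℕ =>
      (-((n + 1 : ℝ) * Complex.I)) • A.resolvent hA ((n + 1 : ℝ) * Complex.I) (v : E))
      atTop (𝓝 (v : E)) := by
    intro v
    have heq : ∀ n : ℕ,
        (-((n + 1 : ℝ) * Complex.I)) • A.resolvent hA ((n + 1 : ℝ) * Complex.I) (v : E) =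
          v - A.resolvent hA ((n + 1 : ℝ) * Complex.I) (A v) := by
      intro n
      have h := resolvent_shift hA (hne n) v
      rw [shift_apply, _root_.map_sub, _root_.map_smul] at h
      rw [eq_sub_iff_add_eq, neg_smul, add_comm, ← sub_eq_add_neg, h]
    simp only [heq]
    have h0 : Tendsto (fun n : ℕ => A.resolvent hA ((n + 1 : ℝ) * Complex.I) (A v)) atTop
        (𝓝 0) := by
      refine squeeze_zero_norm (a := fun n : ℕ => (1 / ((n : ℝ) + 1)) * ‖A v‖) (fun n => ?_) ?_
      · have h := norm_resolvent_apply_le hA (hne n) (A v)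
        rwa [him, abs_of_pos (hpos n), inv_eq_one_div] at h
      · simpa using tendsto_one_div_add_atTop_nhds_zero_nat.mul_const ‖A v‖
    simpa using tendsto_const_nhds.sub h0
  rw [Metric.tendsto_atTop]
  intro ε hε
  obtain ⟨v, hv, hvψ⟩ := Metric.dense_iff.mp hA.dense_domain ψ (ε / 3) (by positivity)
  rw [Metric.mem_ball, dist_eq_norm] at hv
  obtain ⟨N, hN⟩ := Metric.tendsto_atTop.mp (hdom ⟨v, hvψ⟩) (ε / 3) (by positivity)
  refine ⟨N, fun n hn => ?_⟩
  have h1 := hN n hn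
  have h2 := hle n (ψ - v)
  rw [_root_.map_sub, smul_sub] at h2
  rw [norm_sub_rev] at hv
  rw [dist_eq_norm] at h1 ⊢
  set S := (-((n + 1 : ℝ) * Complex.I)) • A.resolvent hA ((n + 1 : ℝ) * Complex.I) ψ
  set S' := (-((n + 1 : ℝ) * Complex.I)) • A.resolvent hA ((n + 1 : ℝ) * Complex.I) v
  calc ‖S - ψ‖ = ‖(S - S') + (S' - v) - (ψ - v)‖ := by congr 1; abel
    _ ≤ ‖S - S'‖ + ‖S' - v‖ + ‖ψ - v‖ :=
      (norm_sub_le _ _).trans (by gcongr; exact norm_add_le _ _)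
    _ < ε := by linarith

/-- The inverse Cayley transform `u ↦ i (1 + u) / (1 - u)` on the spectrum. -/
def inverseCayley (A : E →ₗ.[ℂ] E) (hA : IsSelfAdjoint A) (u : spectrum ℂ (A.cayley hA)) : ℝ :=
  (Complex.I * (1 + (u : ℂ)) / (1 - (u : ℂ))).re

theorem measurable_inverseCayley (A : E →ₗ.[ℂ] E) (hA : IsSelfAdjoint A) :
    Measurable (A.inverseCayley hA) := by
  unfold inverseCayley
  fun_prop

theorem spectralMeasure_eq (A : E →ₗ.[ℂ] E) (hA : IsSelfAdjoint A) (ψ : E) :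
    A.spectralMeasure hA ψ =
      (RealRMK.rieszMeasure (A.cayleyFunctional hA ψ)).map (A.inverseCayley hA) := rfl

instance (A : E →ₗ.[ℂ] E) (hA : IsSelfAdjoint A) (ψ : E) :
    IsFiniteMeasure (A.spectralMeasure hA ψ) := by
  rw [spectralMeasure_eq]
  infer_instance

theorem sub_ne_zero_of_im_ne_zero {z : ℂ} (hz : z.im ≠ 0) (t : ℝ) : (t : ℂ) - z ≠ 0 := by
  intro h
  apply hz
  rw [← sub_eq_zero.mp h, Complex.ofReal_im]

theorem inv_inverseCayley_sub {A : E →ₗ.[ℂ] E} (hA : IsSelfAdjoint A) {z : ℂ} (hz : z.im ≠ 0)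
    {u : spectrum ℂ (A.cayley hA)} (hu : (u : ℂ) ≠ 1) :
    ((A.inverseCayley hA u : ℂ) - z)⁻¹ = A.cayleyResolventFunction hA z hz u := by
  have h1 : (1 - (u : ℂ)) ≠ 0 := sub_ne_zero.mpr hu.symm
  -- On the unit circle `conj u = u⁻¹`, which makes the Cayley quotient real.
  have hreal : (A.inverseCayley hA u : ℂ) = Complex.I * (1 + (u : ℂ)) / (1 - (u : ℂ)) := by
    apply Complex.conj_eq_iff_re.mp
    have hn := norm_eq_one_of_mem_spectrum_cayley hA u.2
    have hu0 : (u : ℂ) ≠ 0 := by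
      intro h; rw [h, norm_zero] at hn; exact zero_ne_one hn
    have hc : conj (u : ℂ) = (u : ℂ)⁻¹ := by
      rw [Complex.inv_def, Complex.normSq_eq_norm_sq, hn]; simp
    have h2 : (u : ℂ) - 1 ≠ 0 := sub_ne_zero.mpr hu
    rw [map_div₀, _root_.map_mul, _root_.map_add, _root_.map_sub, _root_.map_one, hc, Complex.conj_I]
    rw [show 1 - (u : ℂ)⁻¹ = ((u : ℂ) - 1) / u by field_simp]
    field_simp
    ring
  have hne := sub_ne_zero_of_im_ne_zero hz (A.inverseCayley hA u)
  have hd := resolventFunction_denominator_ne_zero hA hz u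
  change _ = (1 - (u : ℂ)) / ((Complex.I - z) + (Complex.I + z) * u)
  rw [hreal] at hne ⊢
  have : Complex.I * (1 + (u : ℂ)) / (1 - (u : ℂ)) - z =
      ((Complex.I - z) + (Complex.I + z) * u) / (1 - u) := by
    field_simp
    ring
  rw [this, inv_div]

/-- Division by zero sends `u = 1` to `t = 0`, so an atom there would create spurious spectral mass.
The functions `-iη / (t - iη)` vanish at `u = 1` and tend boundedly to `1` elsewhere, so their
integrals tend to the mass of the complement; by `tendsto_smul_resolvent` they also tend to `⟪ψ,
ψ⟫`, the total mass. -/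
theorem rieszMeasure_singleton_one {A : E →ₗ.[ℂ] E} (hA : IsSelfAdjoint A) (ψ : E) :
    RealRMK.rieszMeasure (A.cayleyFunctional hA ψ)
      {u : spectrum ℂ (A.cayley hA) | (u : ℂ) = 1} = 0 := by
  set m := RealRMK.rieszMeasure (A.cayleyFunctional hA ψ) with hm
  set S := {u : spectrum ℂ (A.cayley hA) | (u : ℂ) = 1} with hS
  have hSm : MeasurableSet S := measurable_subtype_coe (measurableSet_singleton 1)
  have him : ∀ n : ℕ, (((n + 1 : ℝ) : ℂ) * Complex.I).im = n + 1 := fun n => by simp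
  have hpos : ∀ n : ℕ, (0 : ℝ) < n + 1 := fun n => by positivity
  have hne : ∀ n : ℕ, (((n + 1 : ℝ) : ℂ) * Complex.I).im ≠ 0 := fun n => by
    rw [him]; exact (hpos n).ne'
  have htot : ∫ u, (1 : ℂ) ∂m = ⟪ψ, ψ⟫_ℂ := by
    have h := integral_cayleyFunctional hA ψ 1
    rw [_root_.map_one] at h
    exact h
  have hone : ∀ n : ℕ, ∀ u ∈ S,
      A.cayleyResolventFunction hA (((n + 1 : ℝ) : ℂ) * Complex.I) (hne n) u = 0 := by
    intro n u hu
    change (1 - (u : ℂ)) / _ = 0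
    rw [show (u : ℂ) = 1 from hu, sub_self, zero_div]
  have hlim : Tendsto (fun n : ℕ => ∫ u, (-(((n + 1 : ℝ) : ℂ) * Complex.I)) *
      A.cayleyResolventFunction hA (((n + 1 : ℝ) : ℂ) * Complex.I) (hne n) u ∂m) atTop
      (𝓝 (∫ u, Sᶜ.indicator 1 u ∂m)) := by
    refine tendsto_integral_of_dominated_convergence (fun _ => 1) (fun n => ?_)
      (integrable_const _) (fun n => ae_of_all _ fun u => ?_) (ae_of_all _ fun u => ?_)
    · exact (continuous_const.mul (map_continuous _)).aestronglyMeasurable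
    · by_cases hu : u ∈ S
      · rw [hone n u hu, mul_zero, norm_zero]; exact zero_le_one
      · rw [← inv_inverseCayley_sub hA (hne n) hu, ← div_eq_mul_inv, norm_div]
        refine div_le_one_of_le₀ ?_ (norm_nonneg _)
        refine le_trans ?_ (Complex.abs_im_le_norm _)
        rw [Complex.sub_im, Complex.ofReal_im, him, norm_neg, norm_mul, Complex.norm_I, mul_one,
          Complex.norm_real, Real.norm_eq_abs, zero_sub, abs_neg]
    · by_cases hu : u ∈ S
      · simp only [hone _ u hu, mul_zero]
        simp [hu]
      · rw [Set.indicator_of_mem (by exact hu), Pi.one_apply]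
        simp only [← inv_inverseCayley_sub hA (hne _) hu]
        set t := A.inverseCayley hA u
        have h1 : ∀ n : ℕ, -(((n + 1 : ℝ) : ℂ) * Complex.I) *
            ((t : ℂ) - ((n + 1 : ℝ) : ℂ) * Complex.I)⁻¹ =
            (1 + (t * Complex.I) * ((1 / ((n : ℝ) + 1) : ℝ) : ℂ))⁻¹ := by
          intro n
          have h2 := sub_ne_zero_of_im_ne_zero (hne n) t
          have h3 : ((n + 1 : ℝ) : ℂ) ≠ 0 := by exact_mod_cast (hpos n).ne'
          have h4 : (1 + (t * Complex.I) * ((1 / ((n : ℝ) + 1) : ℝ) : ℂ)) =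
              ((t : ℂ) - ((n + 1 : ℝ) : ℂ) * Complex.I) /
                (-(((n + 1 : ℝ) : ℂ) * Complex.I)) := by
            rw [eq_div_iff (neg_ne_zero.mpr (mul_ne_zero h3 Complex.I_ne_zero)),
              Complex.ofReal_div, Complex.ofReal_one]
            field_simp
            linear_combination (-(t : ℂ)) * Complex.I_sq
          rw [h4, inv_div, div_eq_mul_inv]
        simp only [h1]
        have h5 : Tendsto (fun n : ℕ => ((1 / ((n : ℝ) + 1) : ℝ) : ℂ)) atTop (𝓝 0) := by
          have := (Complex.continuous_ofReal.tendsto 0).comp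
            (tendsto_one_div_add_atTop_nhds_zero_nat (𝕜 := ℝ))
          simpa only [Function.comp_def, Complex.ofReal_zero] using this
        have h6 := ((h5.const_mul (t * Complex.I)).const_add 1).inv₀ (by simp)
        simpa using h6
  have hlim2 : Tendsto (fun n : ℕ => ∫ u, (-(((n + 1 : ℝ) : ℂ) * Complex.I)) *
      A.cayleyResolventFunction hA (((n + 1 : ℝ) : ℂ) * Complex.I) (hne n) u ∂m) atTop
      (𝓝 ⟪ψ, ψ⟫_ℂ) := by
    have h : ∀ n : ℕ, ∫ u, (-(((n + 1 : ℝ) : ℂ) * Complex.I)) *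
        A.cayleyResolventFunction hA (((n + 1 : ℝ) : ℂ) * Complex.I) (hne n) u ∂m =
        ⟪ψ, (-((n + 1 : ℝ) * Complex.I)) •
          A.resolvent hA ((n + 1 : ℝ) * Complex.I) ψ⟫_ℂ := by
      intro n
      rw [integral_const_mul, integral_cayleyFunctional, cfcHom_cayleyResolventFunction,
        inner_smul_right]
    simp only [h]
    exact (tendsto_const_nhds (x := ψ)).inner (tendsto_smul_resolvent hA ψ)
  have heq := tendsto_nhds_unique hlim hlim2
  rw [← htot, integral_indicator hSm.compl] at heq
  simp only [Pi.one_apply, integral_const, measureReal_restrict_apply MeasurableSet.univ,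
    Set.univ_inter, Complex.real_smul, mul_one] at heq
  have h2 : m.real Sᶜ = m.real Set.univ := by exact_mod_cast heq
  have h3 := measureReal_add_measureReal_compl (μ := m) hSm
  have h4 : m.real S = 0 := by linarith
  exact (measureReal_eq_zero_iff).mp h4

/-- Away from the null set `u = 1`, the integrand pulled back to the circle is the continuous
function whose functional calculus is the resolvent. -/
theorem integral_inv_sub_spectralMeasure {A : E →ₗ.[ℂ] E} (hA : IsSelfAdjoint A) {z : ℂ}
    (hz : z.im ≠ 0) (ψ : E) :
    ∫ t : ℝ, ((t : ℂ) - z)⁻¹ ∂A.spectralMeasure hA ψ = ⟪ψ, A.resolvent hA z ψ⟫_ℂ := by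
  rw [spectralMeasure_eq, integral_map (A.measurable_inverseCayley hA).aemeasurable (by fun_prop),
    ← cfcHom_cayleyResolventFunction hA hz, ← integral_cayleyFunctional]
  refine integral_congr_ae ?_
  have h : ∀ᵐ u ∂(RealRMK.rieszMeasure (A.cayleyFunctional hA ψ)), ((u : spectrum ℂ (A.cayley hA)) : ℂ) ≠ 1 := by
    rw [ae_iff]
    simpa only [not_not] using rieszMeasure_singleton_one hA ψ
  filter_upwards [h] with u hu
  exact inv_inverseCayley_sub hA hz hu

theorem integral_one_spectralMeasure {A : E →ₗ.[ℂ] E} (hA : IsSelfAdjoint A) (ψ : E) :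
    ∫ _ : ℝ, (1 : ℂ) ∂A.spectralMeasure hA ψ = ⟪ψ, ψ⟫_ℂ := by
  rw [spectralMeasure_eq, integral_map (A.measurable_inverseCayley hA).aemeasurable (by fun_prop)]
  have h := integral_cayleyFunctional hA ψ 1
  rw [_root_.map_one] at h
  exact h

theorem real_univ_spectralMeasure {A : E →ₗ.[ℂ] E} (hA : IsSelfAdjoint A) (ψ : E) :
    (A.spectralMeasure hA ψ).real Set.univ = ‖ψ‖ ^ 2 := by
  have h := integral_one_spectralMeasure hA ψ
  rw [integral_const, Complex.real_smul, mul_one, inner_self_eq_norm_sq_to_K] at h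
  exact Complex.ofReal_injective (by rw [h]; simp)

/-! ### The polarized Borel functional calculus. -/

theorem borelForm_inv_sub {A : E →ₗ.[ℂ] E} (hA : IsSelfAdjoint A) {z : ℂ} (hz : z.im ≠ 0)
    (φ ψ : E) :
    A.borelForm hA (fun t => ((t : ℂ) - z)⁻¹) φ ψ = ⟪φ, A.resolvent hA z ψ⟫_ℂ := by
  simp only [borelForm, integral_inv_sub_spectralMeasure hA hz]
  exact polarization_inner _ φ ψ

theorem borelForm_one {A : E →ₗ.[ℂ] E} (hA : IsSelfAdjoint A) (φ ψ : E) :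
    A.borelForm hA (fun _ => 1) φ ψ = ⟪φ, ψ⟫_ℂ := by
  simp only [borelForm, integral_one_spectralMeasure hA]
  exact polarization_inner (1 : E →L[ℂ] E) φ ψ

theorem integrable_spectralMeasure_of_norm_le {A : E →ₗ.[ℂ] E} (hA : IsSelfAdjoint A)
    {f : ℝ → ℂ} (hf : Measurable f) {C : ℝ} (hC : ∀ t, ‖f t‖ ≤ C) (ψ : E) :
    Integrable f (A.spectralMeasure hA ψ) :=
  Integrable.of_bound hf.aestronglyMeasurable C (ae_of_all _ hC)

theorem borelForm_add {A : E →ₗ.[ℂ] E} (hA : IsSelfAdjoint A) {f g : ℝ → ℂ}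
    (hf : ∀ χ, Integrable f (A.spectralMeasure hA χ))
    (hg : ∀ χ, Integrable g (A.spectralMeasure hA χ)) (φ ψ : E) :
    A.borelForm hA (fun t => f t + g t) φ ψ = A.borelForm hA f φ ψ + A.borelForm hA g φ ψ := by
  simp only [borelForm, integral_add (hf _) (hg _)]
  ring

theorem borelForm_const_mul {A : E →ₗ.[ℂ] E} (hA : IsSelfAdjoint A) (c : ℂ) (f : ℝ → ℂ)
    (φ ψ : E) : A.borelForm hA (fun t => c * f t) φ ψ = c * A.borelForm hA f φ ψ := by
  simp only [borelForm, integral_const_mul]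
  ring

theorem borelForm_sum {A : E →ₗ.[ℂ] E} (hA : IsSelfAdjoint A) {ι : Type*} (s : Finset ι)
    {f : ι → ℝ → ℂ} (hf : ∀ i χ, Integrable (f i) (A.spectralMeasure hA χ)) (φ ψ : E) :
    A.borelForm hA (fun t => ∑ i ∈ s, f i t) φ ψ = ∑ i ∈ s, A.borelForm hA (f i) φ ψ := by
  simp only [borelForm, integral_finsetSum s (fun i _ => hf i _), Finset.mul_sum,
    ← Finset.sum_sub_distrib, ← Finset.sum_add_distrib]

theorem norm_borelForm_le {A : E →ₗ.[ℂ] E} (hA : IsSelfAdjoint A) {f : ℝ → ℂ} {C : ℝ}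
    (hC : ∀ t, ‖f t‖ ≤ C) (φ ψ : E) :
    ‖A.borelForm hA f φ ψ‖ ≤ C * (‖φ‖ ^ 2 + ‖ψ‖ ^ 2) := by
  have h : ∀ χ, ‖∫ t, f t ∂A.spectralMeasure hA χ‖ ≤ C * ‖χ‖ ^ 2 := fun χ => by
    rw [← real_univ_spectralMeasure hA]
    exact norm_integral_le_of_norm_le_const (ae_of_all _ hC)
  have p1 := parallelogram_law_with_norm ℂ φ ψ
  have p2 := parallelogram_law_with_norm ℂ φ (Complex.I • ψ)
  rw [norm_smul, Complex.norm_I, one_mul] at p2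
  rw [borelForm, norm_mul]
  have h4 : ‖(4⁻¹ : ℂ)‖ = 4⁻¹ := by simp
  rw [h4]
  calc _ ≤ 4⁻¹ * (C * ‖φ + ψ‖ ^ 2 + C * ‖φ - ψ‖ ^ 2 + C * ‖φ + Complex.I • ψ‖ ^ 2 +
        C * ‖φ - Complex.I • ψ‖ ^ 2) := by
        gcongr
        refine (norm_add_le _ _).trans (add_le_add ((norm_sub_le _ _).trans
          (add_le_add ((norm_sub_le _ _).trans (add_le_add (h _) (h _))) ?_)) ?_)
        · rw [norm_mul, Complex.norm_I, one_mul]; exact h _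
        · rw [norm_mul, Complex.norm_I, one_mul]; exact h _
    -- By two parallelogram laws the four squared norms add up to `4 (‖φ‖² + ‖ψ‖²)`.
    _ = _ := by linear_combination (C / 4) * (p1 + p2)

/-- Spectral measures are finite, so bounded pointwise convergence suffices. The Fermi function and
the projection are reached from resolvents in this way, without being constructed as operators. -/
theorem tendsto_borelForm {A : E →ₗ.[ℂ] E} (hA : IsSelfAdjoint A) {ι : Type*} {l : Filter ι}
    [l.IsCountablyGenerated] {F : ι → ℝ → ℂ} {f : ℝ → ℂ} {C : ℝ}
    (hF : ∀ n, Measurable (F n)) (hC : ∀ n t, ‖F n t‖ ≤ C)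
    (hlim : ∀ t, Tendsto (fun n => F n t) l (𝓝 (f t))) (φ ψ : E) :
    Tendsto (fun n => A.borelForm hA (F n) φ ψ) l (𝓝 (A.borelForm hA f φ ψ)) := by
  have h : ∀ χ, Tendsto (fun n => ∫ t, F n t ∂A.spectralMeasure hA χ) l
      (𝓝 (∫ t, f t ∂A.spectralMeasure hA χ)) := fun χ =>
    tendsto_integral_filter_of_dominated_convergence (fun _ => C)
      (Eventually.of_forall fun n => (hF n).aestronglyMeasurable)
      (Eventually.of_forall fun n => ae_of_all _ (hC n)) (integrable_const _) (ae_of_all _ hlim)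
  exact ((((h _).sub (h _)).sub ((h _).const_mul _)).add ((h _).const_mul _)).const_mul _

end LinearPMap

/-! ### Matsubara expansion of the Fermi distribution. -/

section FermiSeries

open Filter Topology Real

/-- The Mittag-Leffler series of `π cot(π w)` at the imaginary point `w = -i x / π`. -/
theorem Real.hasSum_coth {x : ℝ} (hx : x ≠ 0) :
    HasSum (fun n : ℕ => 2 * x / (x ^ 2 + (π * (n + 1)) ^ 2)) (cosh x / sinh x - 1 / x) := by
  have hmem : -(x / π : ℂ) * Complex.I ∈ Complex.integerComplement := by
    rintro ⟨n, hn⟩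
    have h := congrArg Complex.im hn
    simp [← Complex.ofReal_div, hx] at h
  have hs := (summable_cotTerm hmem).hasSum
  have hpi : (π : ℂ) ≠ 0 := by exact_mod_cast Real.pi_ne_zero
  have hxc : (x : ℂ) ≠ 0 := by exact_mod_cast hx
  have hI := Complex.I_ne_zero
  change HasSum _ (∑' n : ℕ, (1 / (_ - ((n : ℂ) + 1)) + 1 / (_ + ((n : ℂ) + 1)))) at hs
  rw [← cot_series_rep' hmem] at hs
  have hs2 := hs.mul_left (-Complex.I / π)
  rw [← Complex.hasSum_ofReal]
  convert! hs2 using 1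
  · funext n
    rw [cotTerm_identity hmem]
    have h1 : ((x ^ 2 + (π * (n + 1)) ^ 2 : ℝ) : ℂ) ≠ 0 := by
      have : 0 < x ^ 2 + (π * (n + 1)) ^ 2 := by positivity
      exact_mod_cast this.ne'
    push_cast at h1 ⊢
    have h2 : (-(x / π : ℂ) * Complex.I + (n + 1)) * (-(x / π : ℂ) * Complex.I - (n + 1)) =
       -(x ^ 2 + (π * (n + 1)) ^ 2) / π ^ 2 := by
      field_simp
      linear_combination (x : ℂ) ^ 2 * Complex.I_sq
    rw [h2]
    field_simp
    linear_combination ((x : ℂ) ^ 2 + (π * (n + 1)) ^ 2)⁻¹ * Complex.I_sq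
  · have h1 : (π : ℂ) * (-(x / π : ℂ) * Complex.I) = -(x * Complex.I) := by field_simp
    have h2 : Complex.sinh x ≠ 0 := by
      rw [← Complex.ofReal_sinh]
      exact_mod_cast fun h => hx (Real.sinh_eq_zero.mp h)
    rw [h1, Complex.cot, Complex.cos_neg, Complex.sin_neg, Complex.cos_mul_I, Complex.sin_mul_I]
    push_cast
    field_simp
    ring

/-- Both sides are `tanh (x/2)`: the left by `tanh (x/2) = 2 coth x - coth (x/2)`, in which the pole
terms cancel. -/
theorem tanh_half {x : ℝ} (hx : x ≠ 0) :
    2 * (cosh x / sinh x - 1 / x) - (cosh (x / 2) / sinh (x / 2) - 1 / (x / 2)) =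
      1 - 2 * fermiDistribution 1 x := by
  have h1 : sinh (x / 2) ≠ 0 := by
    rw [Ne, Real.sinh_eq_zero]; simpa using hx
  have h2 := Real.cosh_pos (x / 2)
  have h3 : sinh x = 2 * sinh (x / 2) * cosh (x / 2) := by rw [← Real.sinh_two_mul]; ring_nf
  have h4 : cosh x = cosh (x / 2) ^ 2 + sinh (x / 2) ^ 2 := by rw [← Real.cosh_two_mul]; ring_nf
  have h5 : 1 - 2 * fermiDistribution 1 x = sinh (x / 2) / cosh (x / 2) := by
    rw [fermiDistribution, div_one, Real.sinh_eq, Real.cosh_eq, Real.exp_neg,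
      show Real.exp x = Real.exp (x / 2) ^ 2 by rw [← Real.exp_nat_mul]; ring_nf]
    have := Real.exp_pos (x / 2)
    field_simp
    ring
  rw [h5, h3, h4]
  field_simp
  ring

theorem hasSum_tanh_half (x : ℝ) :
    HasSum (fun n : ℕ => 4 * x / (x ^ 2 + (π * (2 * n + 1)) ^ 2))
      (1 - 2 * fermiDistribution 1 x) := by
  rcases eq_or_ne x 0 with rfl | hx
  · have : 1 - 2 * fermiDistribution 1 0 = 0 := by norm_num [fermiDistribution]
    rw [this]
    simp
  · rw [← tanh_half hx]
    have h1 := (Real.hasSum_coth hx).mul_left 2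
    have h2 := Real.hasSum_coth (x := x / 2) (by simpa using hx)
    -- The series of `coth (x/2)` consists of the odd-index terms of that of `2 coth x`, with
    -- frequencies `π (2n + 2)`. Subtracting it leaves the fermionic frequencies `π (2n + 1)`.
    have h2' : HasSum (fun n : ℕ => 2 * (2 * x / (x ^ 2 + (π * ((2 * n + 1 : ℕ) + 1)) ^ 2)))
        (cosh (x / 2) / sinh (x / 2) - 1 / (x / 2)) := by
      convert! h2 using 1
      funext n
      push_cast
      have : 0 < x ^ 2 + (π * (n + 1)) ^ 2 := by positivity
      field_simp
      ring
    have hinj : Function.Injective (fun n : ℕ => 2 * n) := fun a b h => by simpa using h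
    have he := (h1.summable.comp_injective hinj).hasSum
    have h3 := (HasSum.even_add_odd (f := fun n : ℕ =>
      2 * (2 * x / (x ^ 2 + (π * (n + 1)) ^ 2))) he h2').unique h1
    rw [← h3, add_sub_cancel_right]
    convert! he using 1
    funext n
    simp only [Function.comp]
    push_cast
    ring

theorem fermiDistribution_nonneg (T u : ℝ) : 0 ≤ fermiDistribution T u := by
  unfold fermiDistribution
  positivity

theorem fermiDistribution_le_one (T u : ℝ) : fermiDistribution T u ≤ 1 :=
  inv_le_one_of_one_le₀ (by linarith [Real.exp_pos (u / T)])

/-- All terms have the sign of `x`, so partial sums are dominated by the full sum `tanh (|x|/2) ≤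
1`. This bound, uniform in `x` and `N`, is the one needed for dominated convergence. -/
theorem abs_sum_tanh_half_le (x : ℝ) (N : ℕ) :
    |∑ n ∈ Finset.range N, 4 * x / (x ^ 2 + (π * (2 * n + 1)) ^ 2)| ≤ 1 := by
  refine (Finset.abs_sum_le_sum_abs _ _).trans ?_
  have h : ∀ n : ℕ, |4 * x / (x ^ 2 + (π * (2 * n + 1)) ^ 2)| =
      4 * |x| / (|x| ^ 2 + (π * (2 * n + 1)) ^ 2) := by
    intro n
    rw [abs_div, abs_mul, sq_abs, abs_of_nonneg (by positivity : 0 ≤ x ^ 2 + _),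
      abs_of_pos (by norm_num : (0 : ℝ) < 4)]
  simp only [h]
  refine (sum_le_hasSum _ (fun n _ => by positivity) (hasSum_tanh_half |x|)).trans ?_
  linarith [fermiDistribution_nonneg 1 |x|]

/-- The Matsubara frequencies `π T (2 n + 1)`. -/
def matsubaraFrequency (T : ℝ) (n : ℕ) : ℝ := π * T * (2 * n + 1)

theorem matsubaraFrequency_pos {T : ℝ} (hT : 0 < T) (n : ℕ) : 0 < matsubaraFrequency T n := by
  unfold matsubaraFrequency
  positivity

/-- Partial sums of the expansion of the Fermi distribution over the Matsubara frequencies. -/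
def matsubaraSum (T E : ℝ) (N : ℕ) (t : ℝ) : ℂ :=
  2⁻¹ * 1 + ∑ n ∈ Finset.range N, -(T : ℂ) *
    (((t : ℂ) - (E + (matsubaraFrequency T n : ℂ) * Complex.I))⁻¹ +
      ((t : ℂ) - (E + ((-matsubaraFrequency T n : ℝ) : ℂ) * Complex.I))⁻¹)

theorem matsubaraSum_eq {T : ℝ} (hT : 0 < T) (E : ℝ) (N : ℕ) (t : ℝ) :
    matsubaraSum T E N t = ((1 / 2 - 1 / 2 * ∑ n ∈ Finset.range N,
      4 * ((t - E) / T) / (((t - E) / T) ^ 2 + (π * (2 * n + 1)) ^ 2) : ℝ) : ℂ) := by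
  rw [matsubaraSum, Finset.mul_sum, sub_eq_add_neg, ← Finset.sum_neg_distrib, Complex.ofReal_add,
    Complex.ofReal_sum]
  congr 1
  · norm_num
  · refine Finset.sum_congr rfl fun n _ => ?_
    have hη := (matsubaraFrequency_pos hT n).ne'
    have h1 : (t : ℂ) - (E + (matsubaraFrequency T n : ℂ) * Complex.I) ≠ 0 :=
      LinearPMap.sub_ne_zero_of_im_ne_zero (by simpa using hη) t
    have h2 : (t : ℂ) - (E + ((-matsubaraFrequency T n : ℝ) : ℂ) * Complex.I) ≠ 0 :=
      LinearPMap.sub_ne_zero_of_im_ne_zero (by simpa using hη) t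
    rw [← one_div, ← one_div, div_add_div _ _ h1 h2]
    have h3 : ((t : ℂ) - (E + (matsubaraFrequency T n : ℂ) * Complex.I)) *
        ((t : ℂ) - (E + ((-matsubaraFrequency T n : ℝ) : ℂ) * Complex.I)) =
          (((t - E) ^ 2 + (T * (π * (2 * n + 1))) ^ 2 : ℝ) : ℂ) := by
      rw [matsubaraFrequency]
      push_cast
      linear_combination (-((π : ℂ) * T * (2 * n + 1)) ^ 2) * Complex.I_sq
    rw [h3]
    have h4 : (1 * ((t : ℂ) - (E + ((-matsubaraFrequency T n : ℝ) : ℂ) * Complex.I)) +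
        ((t : ℂ) - (E + (matsubaraFrequency T n : ℂ) * Complex.I)) * 1) =
        ((2 * (t - E) : ℝ) : ℂ) := by
      push_cast
      ring
    rw [h4, ← Complex.ofReal_neg, ← Complex.ofReal_div, ← Complex.ofReal_mul]
    congr 1
    have h5 : 0 < (π * (2 * n + 1)) ^ 2 := by positivity
    have h6 : (t - E) ^ 2 + (T * (π * (2 * n + 1))) ^ 2 ≠ 0 := by positivity
    have h7 : ((t - E) / T) ^ 2 + (π * (2 * n + 1)) ^ 2 =
        ((t - E) ^ 2 + (T * (π * (2 * n + 1))) ^ 2) / T ^ 2 := by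
      field_simp
    rw [h7]
    field_simp
    ring

theorem norm_matsubaraSum_le {T : ℝ} (hT : 0 < T) (E : ℝ) (N : ℕ) (t : ℝ) :
    ‖matsubaraSum T E N t‖ ≤ 1 := by
  rw [matsubaraSum_eq hT, Complex.norm_real, Real.norm_eq_abs]
  have h := abs_le.mp (abs_sum_tanh_half_le ((t - E) / T) N)
  rw [abs_le]
  constructor <;> linarith [h.1, h.2]

theorem tendsto_matsubaraSum {T : ℝ} (hT : 0 < T) (E t : ℝ) :
    Tendsto (fun N => matsubaraSum T E N t) atTop (𝓝 (fermiDistribution T (t - E) : ℂ)) := by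
  simp only [matsubaraSum_eq hT]
  refine (Complex.continuous_ofReal.tendsto _).comp ?_
  have h := ((hasSum_tanh_half ((t - E) / T)).tendsto_sum_nat.const_mul (1 / 2)).const_sub (1 / 2)
  convert! h using 2
  simp only [fermiDistribution, div_one]
  ring

/-- At `u = 0` the value is `1/2` at every temperature, so the limit misses half of the atom that
the projection on `(-∞, E_F]` contains. -/
theorem tendsto_fermiDistribution_zero (u : ℝ) :
    Tendsto (fun n : ℕ => fermiDistribution (1 / ((n : ℝ) + 1)) u) atTop
      (𝓝 ((Set.Iio 0).indicator 1 u + 2⁻¹ * ({0} : Set ℝ).indicator 1 u)) := by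
  have htop : Tendsto (fun n : ℕ => (n : ℝ) + 1) atTop atTop :=
    tendsto_natCast_atTop_atTop.atTop_add tendsto_const_nhds
  simp only [fermiDistribution, div_div_eq_mul_div, div_one]
  rcases lt_trichotomy u 0 with hu | rfl | hu
  · have h : Tendsto (fun n : ℕ => Real.exp (u * ((n : ℝ) + 1))) atTop (𝓝 0) :=
      Real.tendsto_exp_atBot.comp (htop.const_mul_atTop_of_neg hu)
    have h2 := (h.const_add 1).inv₀ (by norm_num)
    simpa [hu, hu.ne] using h2
  · norm_num
  · have h : Tendsto (fun n : ℕ => Real.exp (u * ((n : ℝ) + 1))) atTop atTop :=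
      Real.tendsto_exp_atTop.comp (htop.const_mul_atTop hu)
    have h2 := (tendsto_atTop_add_const_left _ 1 h).inv_tendsto_atTop
    simpa [hu.le, hu.ne', Pi.inv_def] using h2

end FermiSeries

/-! ### Deterministic bounds on the Green function. -/

section Lattice

variable {d : ℕ}

theorem latticeDist_eq_dist (x y : Site d) : latticeDist x y =
    dist (WithLp.toLp 2 (fun i => (x i : ℝ)) : EuclideanSpace ℝ (Fin d))
      (WithLp.toLp 2 (fun i => (y i : ℝ))) := by
  rw [EuclideanSpace.dist_eq, latticeDist]
  simp only [Real.dist_eq, sq_abs]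

theorem latticeDist_nonneg (x y : Site d) : 0 ≤ latticeDist x y := Real.sqrt_nonneg _

theorem latticeDist_self (x : Site d) : latticeDist x x = 0 := by
  rw [latticeDist_eq_dist, dist_self]

theorem latticeDist_triangle (x y z : Site d) :
    latticeDist x z ≤ latticeDist x y + latticeDist y z := by
  simp only [latticeDist_eq_dist]
  exact dist_triangle _ _ _

theorem norm_siteKet (x : Site d) : ‖siteKet x‖ = 1 := by
  rw [siteKet, lp.norm_single (by norm_num), norm_one]

theorem siteKet_apply_self (x : Site d) : siteKet x x = 1 :=
  lp.single_apply_self (E := fun _ : Site d => ℂ) 2 x (1 : ℂ)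

theorem siteKet_apply_ne {x y : Site d} (h : y ≠ x) : siteKet x y = 0 :=
  lp.single_apply_ne (E := fun _ : Site d => ℂ) 2 x (1 : ℂ) h

variable {K : Site d → Site d → ℂ} (hK : IsShortRangeHopping K) (v : Site d → ℝ)

theorem greenFunction_eq_apply (z : ℂ) (x y : Site d) : greenFunction K hK v z x y =
    (hamiltonian K hK v).resolvent (isSelfAdjoint_hamiltonian hK v) z (siteKet y) x := by
  rw [greenFunction, inner_siteKet]

theorem norm_resolvent_siteKet_le {z : ℂ} (hz : z.im ≠ 0) (y : Site d) :
    ‖(hamiltonian K hK v).resolvent (isSelfAdjoint_hamiltonian hK v) z (siteKet y)‖ ≤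
      |z.im|⁻¹ := by
  have h := LinearPMap.norm_resolvent_apply_le (isSelfAdjoint_hamiltonian hK v) hz (siteKet y)
  rwa [norm_siteKet, mul_one] at h

theorem norm_greenFunction_le {z : ℂ} (hz : z.im ≠ 0) (x y : Site d) :
    ‖greenFunction K hK v z x y‖ ≤ |z.im|⁻¹ := by
  rw [greenFunction_eq_apply]
  exact (lp.norm_apply_le_norm two_ne_zero _ x).trans (norm_resolvent_siteKet_le hK v hz y)

/-- The equation `(H - z) G = 1`, solved for the diagonal part of `H`. -/
theorem sub_mul_greenFunction {z : ℂ} (hz : z.im ≠ 0) (x y : Site d) :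
    ((v x : ℂ) - z) * greenFunction K hK v z x y =
      siteKet y x - ∑' w, K x w * greenFunction K hK v z w y := by
  simp only [greenFunction_eq_apply]
  obtain ⟨u, hu1, hu2⟩ :=
    LinearPMap.exists_shift_resolvent (isSelfAdjoint_hamiltonian hK v) hz (siteKet y)
  rw [← hu1, ← hu2, LinearPMap.shift_apply, lp.coeFn_sub, lp.coeFn_smul, Pi.sub_apply,
    Pi.smul_apply, hamiltonian_apply, hamiltonianAction, smul_eq_mul]
  ring

theorem summable_norm_mul_greenFunction (z : ℂ) (x y : Site d) :
    Summable fun w => ‖K x w‖ * ‖greenFunction K hK v z w y‖ := by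
  have h := (hK.summable_row ((hamiltonian K hK v).resolvent
    (isSelfAdjoint_hamiltonian hK v) z (siteKet y)) x).norm
  simpa only [norm_mul, greenFunction_eq_apply] using h

/-- The potential is real, so `|v x - z| ≥ |Im z|` whatever its size; hence every later bound is
uniform in the potential. -/
theorem im_mul_norm_greenFunction_le {z : ℂ} (hz : z.im ≠ 0) (x y : Site d) :
    |z.im| * ‖greenFunction K hK v z x y‖ ≤
      ‖siteKet y x‖ + ∑' w, ‖K x w‖ * ‖greenFunction K hK v z w y‖ := by
  have h1 : |z.im| ≤ ‖(v x : ℂ) - z‖ := by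
    have := Complex.abs_im_le_norm ((v x : ℂ) - z)
    simpa using this
  have hs := summable_norm_mul_greenFunction hK v z x y
  have h2 : ‖∑' w, K x w * greenFunction K hK v z w y‖ ≤
      ∑' w, ‖K x w‖ * ‖greenFunction K hK v z w y‖ := by
    simpa only [norm_mul] using norm_tsum_le_tsum_norm (f := fun w =>
      K x w * greenFunction K hK v z w y) (by simpa only [norm_mul] using hs)
  calc _ ≤ ‖(v x : ℂ) - z‖ * ‖greenFunction K hK v z x y‖ := by gcongr
    _ = ‖siteKet y x - ∑' w, K x w * greenFunction K hK v z w y‖ := by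
      rw [← norm_mul, sub_mul_greenFunction hK v hz]
    _ ≤ _ := (norm_sub_le _ _).trans (by gcongr)

/-- The Combes-Thomas bound at large distance from the real axis, for an arbitrary potential. -/
theorem norm_greenFunction_le_exp {ν B : ℝ} (hν : 0 < ν)
    (hB : ∀ x, Summable (fun y => ‖K x y‖ * Real.exp (ν * latticeDist x y)) ∧
      ∑' y, ‖K x y‖ * Real.exp (ν * latticeDist x y) ≤ B)
    {z : ℂ} (hz : B < |z.im|) (x y : Site d) :
    ‖greenFunction K hK v z x y‖ ≤ (|z.im| - B)⁻¹ * Real.exp (-(ν * latticeDist x y)) := by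
  have hB0 : 0 ≤ B := (tsum_nonneg fun _ => by positivity).trans (hB x).2
  have hz0 : z.im ≠ 0 := abs_pos.mp (hB0.trans_lt hz)
  set R := ν * latticeDist x y with hR
  have hR0 : 0 ≤ R := mul_nonneg hν.le (latticeDist_nonneg x y)
  -- The weight is capped at its value at `x`, so the weighted supremum `M` is finite a priori and
  -- `M |Im z| ≤ 1 + B M` can be solved for `M`.
  let ρ : Site d → ℝ := fun a => Real.exp (min (ν * latticeDist a y) R)
  have hρ : ∀ a b, ρ a ≤ Real.exp (ν * latticeDist a b) * ρ b := by
    intro a b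
    rw [← Real.exp_add]
    refine Real.exp_le_exp.mpr ?_
    have h1 := mul_le_mul_of_nonneg_left (latticeDist_triangle a b y) hν.le
    have h2 := mul_nonneg hν.le (latticeDist_nonneg a b)
    rcases min_cases (ν * latticeDist b y) R with ⟨h, _⟩ | ⟨h, _⟩ <;> rw [h]
    · exact (min_le_left _ _).trans (by linarith)
    · exact (min_le_right _ _).trans (by linarith)
  have hbdd : BddAbove (Set.range fun a => ‖greenFunction K hK v z a y‖ * ρ a) := by
    refine ⟨|z.im|⁻¹ * Real.exp R, ?_⟩
    rintro _ ⟨a, rfl⟩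
    exact mul_le_mul (norm_greenFunction_le hK v hz0 a y)
      (Real.exp_le_exp.mpr (min_le_right _ _)) (Real.exp_pos _).le (by positivity)
  set M := ⨆ a, ‖greenFunction K hK v z a y‖ * ρ a with hM
  have hle : ∀ a, ‖greenFunction K hK v z a y‖ * ρ a ≤ M := fun a => le_ciSup hbdd a
  have hM0 : 0 ≤ M := (mul_nonneg (norm_nonneg _) (Real.exp_pos _).le).trans (hle x)
  have hstep : ∀ a, ‖greenFunction K hK v z a y‖ * ρ a ≤ |z.im|⁻¹ * (1 + B * M) := by
    intro a
    have h1 := im_mul_norm_greenFunction_le hK v hz0 a y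
    have h2 : ‖siteKet y a‖ * ρ a ≤ 1 := by
      by_cases h : a = y
      · subst h
        simp [ρ, siteKet_apply_self, latticeDist_self, hR0]
      · rw [siteKet_apply_ne h]; simp
    have h3 : (∑' w, ‖K a w‖ * ‖greenFunction K hK v z w y‖) * ρ a ≤ B * M := by
      rw [← tsum_mul_right]
      calc _ ≤ ∑' w, (‖K a w‖ * Real.exp (ν * latticeDist a w)) * M := by
            refine ((summable_norm_mul_greenFunction hK v z a y).mul_right _).tsum_le_tsum
              (fun w => ?_) ((hB a).1.mul_right M)
            calc _ ≤ ‖K a w‖ * ‖greenFunction K hK v z w y‖ *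
                  (Real.exp (ν * latticeDist a w) * ρ w) := by gcongr; exact hρ a w
              _ = ‖K a w‖ * Real.exp (ν * latticeDist a w) *
                  (‖greenFunction K hK v z w y‖ * ρ w) := by ring
              _ ≤ _ := by gcongr; exact hle w
        _ ≤ B * M := by
            rw [tsum_mul_right]
            exact mul_le_mul_of_nonneg_right (hB a).2 hM0
    rw [inv_mul_eq_div, le_div_iff₀ (abs_pos.mpr hz0)]
    calc _ = |z.im| * ‖greenFunction K hK v z a y‖ * ρ a := by ring
      _ ≤ _ := mul_le_mul_of_nonneg_right h1 (Real.exp_pos _).le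
      _ ≤ _ := by rw [add_mul]; exact add_le_add h2 h3
  have hMle : M ≤ |z.im|⁻¹ * (1 + B * M) := ciSup_le hstep
  rw [inv_mul_eq_div, le_div_iff₀ (abs_pos.mpr hz0)] at hMle
  have hfin : M ≤ (|z.im| - B)⁻¹ := by
    rw [← one_div, le_div_iff₀ (sub_pos.mpr hz)]
    linarith
  have hx := (hle x).trans hfin
  have hρx : ρ x = Real.exp R := by simp [ρ, hR]
  rw [hρx] at hx
  rw [Real.exp_neg, ← div_eq_mul_inv, le_div_iff₀ (Real.exp_pos _)]
  exact hx

/-- Off the diagonal, the Combes-Thomas bound improves to second order in `1 / |Im z|`. -/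
theorem norm_greenFunction_le_exp_of_ne {ν B : ℝ} (hν : 0 < ν)
    (hB : ∀ x, Summable (fun y => ‖K x y‖ * Real.exp (ν * latticeDist x y)) ∧
      ∑' y, ‖K x y‖ * Real.exp (ν * latticeDist x y) ≤ B)
    {z : ℂ} (hz : B < |z.im|) {x y : Site d} (hxy : x ≠ y) :
    ‖greenFunction K hK v z x y‖ ≤
      |z.im|⁻¹ * (B * (|z.im| - B)⁻¹) * Real.exp (-(ν * latticeDist x y)) := by
  have hB0 : 0 ≤ B := (tsum_nonneg fun _ => by positivity).trans (hB x).2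
  have hz0 : z.im ≠ 0 := abs_pos.mp (hB0.trans_lt hz)
  have h1 := im_mul_norm_greenFunction_le hK v hz0 x y
  rw [siteKet_apply_ne hxy, norm_zero, zero_add] at h1
  have hpos : 0 < |z.im| - B := sub_pos.mpr hz
  have h2 : ∑' w, ‖K x w‖ * ‖greenFunction K hK v z w y‖ ≤
      B * ((|z.im| - B)⁻¹ * Real.exp (-(ν * latticeDist x y))) := by
    calc _ ≤ ∑' w, (‖K x w‖ * Real.exp (ν * latticeDist x w)) *
          ((|z.im| - B)⁻¹ * Real.exp (-(ν * latticeDist x y))) := by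
          refine (summable_norm_mul_greenFunction hK v z x y).tsum_le_tsum
            (fun w => ?_) ((hB x).1.mul_right _)
          have h3 : Real.exp (-(ν * latticeDist w y)) ≤
              Real.exp (ν * latticeDist x w) * Real.exp (-(ν * latticeDist x y)) := by
            rw [← Real.exp_add]
            refine Real.exp_le_exp.mpr ?_
            have := mul_le_mul_of_nonneg_left (latticeDist_triangle x w y) hν.le
            linarith
          calc _ ≤ ‖K x w‖ * ((|z.im| - B)⁻¹ * Real.exp (-(ν * latticeDist w y))) := by
                gcongr; exact norm_greenFunction_le_exp hK v hν hB hz w y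
            _ ≤ ‖K x w‖ * ((|z.im| - B)⁻¹ *
                (Real.exp (ν * latticeDist x w) * Real.exp (-(ν * latticeDist x y)))) := by gcongr
            _ = _ := by ring
      _ ≤ _ := by
          rw [tsum_mul_right]
          exact mul_le_mul_of_nonneg_right (hB x).2 (by positivity)
  rw [mul_assoc, mul_assoc, inv_mul_eq_div, le_div_iff₀ (abs_pos.mpr hz0), mul_comm]
  exact h1.trans h2

/-! ### Continuity and measurability of the Green function in the potential. -/

open Filter Topology

theorem inner_hamiltonian_siteKet (x : Site d) (φ : LatticeSpace d) :
    ⟪hamiltonian K hK v ⟨siteKet x, siteKet_mem_domain hK v x⟩, φ⟫_ℂ =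
      hamiltonianAction K v φ x := by
  have hterm : ∀ y, ⟪(hamiltonian K hK v ⟨siteKet x, siteKet_mem_domain hK v x⟩ :
      LatticeSpace d) y, φ y⟫_ℂ = K x y * φ y + v x * ⟪(siteKet x : LatticeSpace d) y, φ y⟫_ℂ := by
    intro y
    rw [hamiltonian_apply, hamiltonianAction_siteKet, hK.hermitian x y]
    simp only [RCLike.inner_apply, _root_.map_add, _root_.map_mul, Complex.conj_ofReal,
      Complex.conj_conj]
    ring
  have hz : ∀ y, y ≠ x →
      (v x : ℂ) * ⟪(siteKet x : LatticeSpace d) y, φ y⟫_ℂ = 0 := fun y hy => by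
    rw [siteKet_apply_ne hy, inner_zero_left, mul_zero]
  have hs : Summable fun y => (v x : ℂ) * ⟪(siteKet x : LatticeSpace d) y, φ y⟫_ℂ :=
    (hasSum_single x hz).summable
  rw [lp.inner_eq_tsum]
  simp only [hterm]
  rw [(hK.summable_row φ x).tsum_add hs, tsum_eq_single x hz, siteKet_apply_self,
    hamiltonianAction]
  simp

/-- A vector `φ` orthogonal to the span solves `H φ = conj z φ` pointwise, so it lies in the maximal
domain and would be an eigenvector with a non-real eigenvalue. -/
theorem topologicalClosure_span_shift_siteKet {z : ℂ} (hz : z.im ≠ 0) :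
    (Submodule.span ℂ (Set.range fun x : Site d => (hamiltonian K hK v).shift z
      ⟨siteKet x, siteKet_mem_domain hK v x⟩)).topologicalClosure = ⊤ := by
  rw [Submodule.topologicalClosure_eq_top_iff, Submodule.eq_bot_iff]
  intro φ hφ
  have h : hamiltonianAction K v φ = conj z • ⇑φ := by
    funext x
    have h1 := Submodule.inner_right_of_mem_orthogonal
      (Submodule.subset_span (Set.mem_range_self x)) hφ
    rw [LinearPMap.shift_apply, inner_sub_left, inner_hamiltonian_siteKet, inner_smul_left,
      inner_siteKet, sub_eq_zero] at h1
    exact h1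
  have hdom : φ ∈ (hamiltonian K hK v).domain := by
    rw [mem_hamiltonian_domain, h]
    exact Memℓp.const_smul (lp.memℓp φ) _
  have h2 : (hamiltonian K hK v).shift (conj z) ⟨φ, hdom⟩ = 0 := by
    rw [LinearPMap.shift_apply, sub_eq_zero]
    refine lp.ext ?_
    exact h
  have h3 := LinearPMap.norm_le_shift (isSelfAdjoint_hamiltonian hK v) (conj z) ⟨φ, hdom⟩
  rw [h2, norm_zero, Complex.conj_im, abs_neg] at h3
  exact norm_eq_zero.mp (le_antisymm
    (nonpos_of_mul_nonpos_right h3 (abs_pos.mpr hz)) (norm_nonneg _))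

/-- Site-by-site convergence suffices: on `(H - z)|x⟩` the two resolvents differ by a multiple of `v
x - w n x`, such vectors span a dense subspace, and the resolvents are bounded by `1/|Im z|`
uniformly in `n`. -/
theorem tendsto_resolvent_of_tendsto_potential {z : ℂ} (hz : z.im ≠ 0) {w : ℕ → Site d → ℝ}
    (hw : Tendsto w atTop (𝓝 v)) (φ : LatticeSpace d) :
    Tendsto (fun n => (hamiltonian K hK (w n)).resolvent (isSelfAdjoint_hamiltonian hK (w n)) z φ)
      atTop (𝓝 ((hamiltonian K hK v).resolvent (isSelfAdjoint_hamiltonian hK v) z φ)) := by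
  set R := fun n => (hamiltonian K hK (w n)).resolvent (isSelfAdjoint_hamiltonian hK (w n)) z
    with hRdef
  set R₀ := (hamiltonian K hK v).resolvent (isSelfAdjoint_hamiltonian hK v) z with hR₀def
  have hpos : 0 < |z.im| := abs_pos.mpr hz
  have hR : ∀ n χ, ‖R n χ‖ ≤ |z.im|⁻¹ * ‖χ‖ := fun n χ =>
    LinearPMap.norm_resolvent_apply_le (isSelfAdjoint_hamiltonian hK (w n)) hz χ
  have hR₀ : ∀ χ, ‖R₀ χ‖ ≤ |z.im|⁻¹ * ‖χ‖ := fun χ =>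
    LinearPMap.norm_resolvent_apply_le (isSelfAdjoint_hamiltonian hK v) hz χ
  have hspan : ∀ χ ∈ Submodule.span ℂ (Set.range fun x : Site d => (hamiltonian K hK v).shift z
      ⟨siteKet x, siteKet_mem_domain hK v x⟩), Tendsto (fun n => R n χ) atTop (𝓝 (R₀ χ)) := by
    intro χ hχ
    induction hχ using Submodule.span_induction with
    | mem χ hχ =>
      obtain ⟨x, rfl⟩ := hχ
      have h1 : ∀ n, (hamiltonian K hK v).shift z ⟨siteKet x, siteKet_mem_domain hK v x⟩ =
          (hamiltonian K hK (w n)).shift z ⟨siteKet x, siteKet_mem_domain hK (w n) x⟩ +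
            ((v x - w n x : ℝ) : ℂ) • siteKet x := by
        intro n
        rw [LinearPMap.shift_apply, LinearPMap.shift_apply]
        refine lp.ext ?_
        funext y
        simp only [lp.coeFn_sub, lp.coeFn_add, lp.coeFn_smul, Pi.sub_apply, Pi.add_apply,
          Pi.smul_apply, hamiltonian_apply, hamiltonianAction_siteKet, smul_eq_mul]
        push_cast
        ring
      have h2 : ∀ n, R n ((hamiltonian K hK v).shift z ⟨siteKet x, siteKet_mem_domain hK v x⟩) =
          siteKet x + ((v x - w n x : ℝ) : ℂ) • R n (siteKet x) := by
        intro n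
        rw [h1 n, _root_.map_add, _root_.map_smul, hRdef]
        simp only
        rw [LinearPMap.resolvent_shift (isSelfAdjoint_hamiltonian hK (w n)) hz]
      simp only [h2]
      rw [hR₀def, LinearPMap.resolvent_shift (isSelfAdjoint_hamiltonian hK v) hz]
      have h3 : Tendsto (fun n => ((v x - w n x : ℝ) : ℂ) • R n (siteKet x)) atTop (𝓝 0) := by
        refine squeeze_zero_norm (a := fun n => |v x - w n x| * |z.im|⁻¹) (fun n => ?_) ?_
        · rw [norm_smul, Complex.norm_real, Real.norm_eq_abs]
          gcongr
          have := hR n (siteKet x)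
          rwa [norm_siteKet, mul_one] at this
        · have h4 := ((tendsto_pi_nhds.mp hw x).const_sub (v x)).abs.mul_const |z.im|⁻¹
          simpa using h4
      simpa using h3.const_add (siteKet x)
    | zero => simp
    | add a b _ _ ha hb => simpa only [_root_.map_add] using ha.add hb
    | smul c a _ ha => simpa only [_root_.map_smul] using ha.const_smul c
  have hdense := topologicalClosure_span_shift_siteKet hK v hz
  rw [Metric.tendsto_atTop]
  intro ε hε
  have hφ : φ ∈ (Submodule.span ℂ (Set.range fun x : Site d => (hamiltonian K hK v).shift z
      ⟨siteKet x, siteKet_mem_domain hK v x⟩)).topologicalClosure := by rw [hdense]; trivial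
  obtain ⟨χ, hχ, hχφ⟩ := Metric.mem_closure_iff.mp hφ (|z.im| * (ε / 3)) (by positivity)
  obtain ⟨N, hN⟩ := Metric.tendsto_atTop.mp (hspan χ hχ) (ε / 3) (by positivity)
  refine ⟨N, fun n hn => ?_⟩
  have h1 := hN n hn
  rw [dist_eq_norm] at h1 hχφ ⊢
  have h0 : |z.im|⁻¹ * ‖φ - χ‖ < ε / 3 := by
    rwa [inv_mul_eq_div, div_lt_iff₀ hpos, mul_comm]
  have h2 := (hR n (φ - χ)).trans_lt h0
  have h3 := (hR₀ (φ - χ)).trans_lt h0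
  calc ‖R n φ - R₀ φ‖ = ‖R n (φ - χ) + (R n χ - R₀ χ) - R₀ (φ - χ)‖ := by
        rw [_root_.map_sub, _root_.map_sub]; congr 1; abel
    _ ≤ ‖R n (φ - χ)‖ + ‖R n χ - R₀ χ‖ + ‖R₀ (φ - χ)‖ :=
      (norm_sub_le _ _).trans (by gcongr; exact norm_add_le _ _)
    _ < ε := by linarith

theorem continuous_greenFunction {z : ℂ} (hz : z.im ≠ 0) (x y : Site d) :
    Continuous fun v : Site d → ℝ => greenFunction K hK v z x y := by
  rw [continuous_iff_seqContinuous]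
  intro w v hw
  exact tendsto_const_nhds.inner (tendsto_resolvent_of_tendsto_potential hK v hz hw (siteKet y))

theorem measurable_greenFunction {Ω : Type*} [MeasurableSpace Ω] {v : Site d → Ω → ℝ}
    (hv : ∀ x, Measurable (v x)) {z : ℂ} (hz : z.im ≠ 0) (x y : Site d) :
    Measurable fun ω => greenFunction K hK (fun a => v a ω) z x y :=
  (continuous_greenFunction hK hz x y).measurable.comp (measurable_pi_lambda _ hv)

end Lattice

/-! ### Bounded convergence in expectation, and a weight with uniformly bounded Matsubara sums. -/

section Expectation

open MeasureTheory Filter Topology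

/-- Measurability of the limit comes out of the convergence, so none has to be known beforehand for
spectral quantities defined separately for each `ω`. -/
theorem integrable_and_integral_norm_le_of_tendsto {Ω : Type*} [MeasurableSpace Ω] {P : Measure Ω}
    [IsFiniteMeasure P] {F : ℕ → Ω → ℂ} {f : Ω → ℂ} {M b : ℝ} {c : ℕ → ℝ}
    (hF : ∀ n, Measurable (F n)) (hM : ∀ n ω, ‖F n ω‖ ≤ M)
    (hlim : ∀ ω, Tendsto (fun n => F n ω) atTop (𝓝 (f ω)))
    (hc : ∀ n, ∫ ω, ‖F n ω‖ ∂P ≤ c n) (hcb : Tendsto c atTop (𝓝 b)) :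
    Integrable f P ∧ ∫ ω, ‖f ω‖ ∂P ≤ b := by
  have hf : Measurable f := measurable_of_tendsto_metrizable hF (tendsto_pi_nhds.mpr hlim)
  have hfM : ∀ ω, ‖f ω‖ ≤ M := fun ω => le_of_tendsto' (hlim ω).norm fun n => hM n ω
  refine ⟨Integrable.of_bound hf.aestronglyMeasurable M (ae_of_all _ hfM), ?_⟩
  have h : Tendsto (fun n => ∫ ω, ‖F n ω‖ ∂P) atTop (𝓝 (∫ ω, ‖f ω‖ ∂P)) :=
    tendsto_integral_of_dominated_convergence (fun _ => M)
      (fun n => (hF n).norm.aestronglyMeasurable) (integrable_const M)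
      (fun n => ae_of_all _ fun ω => by rw [norm_norm]; exact hM n ω)
      (ae_of_all _ fun ω => (hlim ω).norm)
  exact le_of_tendsto_of_tendsto' h hcb hc

/-- An integrable majorant on the half line for `η ^ (s - 1)` near `0` and `η ^ (-2)` near `∞`. -/
def fractionalWeight (s η : ℝ) : ℝ := (η / (1 + η)) ^ (s - 1) / (1 + η) ^ 2

theorem fractionalWeight_nonneg {s η : ℝ} (hη : 0 ≤ η) : 0 ≤ fractionalWeight s η := by
  unfold fractionalWeight
  positivity

/-- With `q = η / (1 + η)`, the weight is the derivative of `q ^ s / s`. It is decreasing, so its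
value at the right endpoint is below its mean; concavity of `q ^ s`, as Bernoulli's inequality,
replaces the integral. -/
theorem mul_fractionalWeight_le {s a b : ℝ} (hs : 0 < s) (hs1 : s < 1) (ha : 0 ≤ a) (hab : a < b) :
    s * (b - a) * fractionalWeight s b ≤ (b / (1 + b)) ^ s - (a / (1 + a)) ^ s := by
  have hb : 0 < b := ha.trans_lt hab
  set p := a / (1 + a) with hp
  set q := b / (1 + b) with hq
  have hp0 : 0 ≤ p := by positivity
  have hq0 : 0 < q := by positivity
  have hqs : q ^ (s - 1) = q ^ s / q := by rw [Real.rpow_sub hq0, Real.rpow_one]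
  have h1 : (p / q) ^ s ≤ 1 + s * (p / q - 1) := by
    have h := rpow_one_add_le_one_add_mul_self (s := p / q - 1)
      (by linarith [div_nonneg hp0 hq0.le]) hs.le hs1.le
    rwa [add_sub_cancel] at h
  rw [Real.div_rpow hp0 hq0.le, div_le_iff₀ (by positivity)] at h1
  have h2 : (b - a) / (1 + b) ^ 2 ≤ q - p := by
    have : q - p = (b - a) / ((1 + b) * (1 + a)) := by
      rw [hp, hq]; field_simp; ring
    rw [this]
    have : 0 ≤ b - a := by linarith
    gcongr
    nlinarith
  calc s * (b - a) * fractionalWeight s b = s * q ^ (s - 1) * ((b - a) / (1 + b) ^ 2) := by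
        rw [fractionalWeight]; ring
    _ ≤ s * q ^ (s - 1) * (q - p) := by gcongr
    _ = q ^ s - (1 + s * (p / q - 1)) * q ^ s := by rw [hqs]; field_simp; ring
    _ ≤ _ := by linarith

theorem sum_fractionalWeight_matsubara_le {s T : ℝ} (hs : 0 < s) (hs1 : s < 1) (hT : 0 < T)
    (N : ℕ) :
    T * ∑ n ∈ Finset.range N, fractionalWeight s (matsubaraFrequency T n) ≤ (Real.pi * s)⁻¹ := by
  have hpi := Real.pi_pos
  let φ : ℝ → ℝ := fun a => (a / (1 + a)) ^ s
  -- The frequency `π T (2n+1)` is the midpoint of `[2πTn, 2πT(n+1)]`. Only the left half is used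
  -- for the comparison; monotonicity of `φ` covers the right half, so that the bounds telescope
  -- from `0`.
  have hstep : ∀ n : ℕ, s * (Real.pi * T) * fractionalWeight s (matsubaraFrequency T n) ≤
      φ (2 * Real.pi * T * (n + 1 : ℕ)) - φ (2 * Real.pi * T * n) := by
    intro n
    have hmono : φ (matsubaraFrequency T n) ≤ φ (2 * Real.pi * T * (n + 1 : ℕ)) := by
      have h0 := matsubaraFrequency_pos hT n
      have hle : matsubaraFrequency T n ≤ 2 * Real.pi * T * (n + 1 : ℕ) := by
        rw [matsubaraFrequency]
        push_cast
        nlinarith [mul_pos hpi hT]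
      have h1 : 0 < 2 * Real.pi * T * (n + 1 : ℕ) := h0.trans_le hle
      refine Real.rpow_le_rpow (by positivity) ?_ hs.le
      rw [div_le_div_iff₀ (by positivity) (by positivity)]
      nlinarith
    have h := mul_fractionalWeight_le hs hs1 (a := 2 * Real.pi * T * n)
      (b := matsubaraFrequency T n) (by positivity) (by
        rw [matsubaraFrequency]; nlinarith [mul_pos hpi hT])
    have hd : matsubaraFrequency T n - 2 * Real.pi * T * n = Real.pi * T := by
      rw [matsubaraFrequency]; ring
    rw [hd] at h
    exact h.trans (sub_le_sub_right hmono _)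
  have hsum := Finset.sum_le_sum fun n (_ : n ∈ Finset.range N) => hstep n
  rw [← Finset.mul_sum, Finset.sum_range_sub (fun n : ℕ => φ (2 * Real.pi * T * n))] at hsum
  have h0 : 0 ≤ φ (2 * Real.pi * T * (0 : ℕ)) := by simp only [φ]; positivity
  have h1 : φ (2 * Real.pi * T * (N : ℕ)) ≤ 1 := by
    have hx : 0 ≤ 2 * Real.pi * T * (N : ℕ) := by positivity
    exact Real.rpow_le_one (by positivity) (div_le_one_of_le₀ (by linarith) (by positivity)) hs.le
  rw [← one_div, le_div_iff₀ (by positivity)]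
  linarith

theorem rpow_le_fractionalWeight {s η r : ℝ} (hs1 : s < 1) (hη : 0 < η) (hr : η ≤ r) :
    η ^ (s - 1) ≤ (1 + r) ^ 2 * fractionalWeight s η := by
  have h1 : η ^ (s - 1) ≤ (η / (1 + η)) ^ (s - 1) :=
    Real.rpow_le_rpow_of_nonpos (by positivity) (div_le_self hη.le (by linarith)) (by linarith)
  have h2 : 1 ≤ (1 + r) ^ 2 / (1 + η) ^ 2 := by
    rw [one_le_div (by positivity)]
    gcongr
  calc η ^ (s - 1) ≤ (η / (1 + η)) ^ (s - 1) * 1 := by rwa [mul_one]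
    _ ≤ (η / (1 + η)) ^ (s - 1) * ((1 + r) ^ 2 / (1 + η) ^ 2) := by gcongr
    _ = _ := by rw [fractionalWeight]; ring

theorem inv_sq_le_fractionalWeight {s η : ℝ} (hs1 : s < 1) (hη : 1 ≤ η) :
    (η ^ 2)⁻¹ ≤ 4 * fractionalWeight s η := by
  have h1 : 1 ≤ (η / (1 + η)) ^ (s - 1) :=
    Real.one_le_rpow_of_pos_of_le_one_of_nonpos (by positivity)
      (div_le_one_of_le₀ (by linarith) (by positivity)) (by linarith)
  calc (η ^ 2)⁻¹ ≤ 4 * (1 / (1 + η) ^ 2) := by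
        rw [← one_div, mul_one_div, div_le_div_iff₀ (by positivity) (by positivity)]
        nlinarith
    _ ≤ _ := by rw [fractionalWeight]; gcongr

/-! ### Kernels of Matsubara sums and their limits. -/

variable {d : ℕ} {K : Site d → Site d → ℂ} (hK : IsShortRangeHopping K)

theorem im_ofReal_add_mul_I (E η : ℝ) : ((E : ℂ) + (η : ℂ) * Complex.I).im = η := by simp

theorem functionKernel_matsubaraSum (v : Site d → ℝ) {T : ℝ} (hT : 0 < T) (E : ℝ) (N : ℕ)
    (x y : Site d) : functionKernel K hK v (matsubaraSum T E N) x y =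
      2⁻¹ * ⟪siteKet x, siteKet y⟫_ℂ + ∑ n ∈ Finset.range N, -(T : ℂ) *
        (greenFunction K hK v (E + (matsubaraFrequency T n : ℂ) * Complex.I) x y +
          greenFunction K hK v (E + ((-matsubaraFrequency T n : ℝ) : ℂ) * Complex.I) x y) := by
  have hA := isSelfAdjoint_hamiltonian hK v
  have hz1 : ∀ n, ((E : ℂ) + (matsubaraFrequency T n : ℂ) * Complex.I).im ≠ 0 := fun n => by
    rw [im_ofReal_add_mul_I]; exact (matsubaraFrequency_pos hT n).ne'
  have hz2 : ∀ n, ((E : ℂ) + ((-matsubaraFrequency T n : ℝ) : ℂ) * Complex.I).im ≠ 0 := fun n => by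
    rw [im_ofReal_add_mul_I]; exact neg_ne_zero.mpr (matsubaraFrequency_pos hT n).ne'
  have hint : ∀ {z : ℂ}, z.im ≠ 0 → ∀ χ, Integrable (fun t : ℝ => ((t : ℂ) - z)⁻¹)
      ((hamiltonian K hK v).spectralMeasure hA χ) := fun {z} hz χ => by
    refine LinearPMap.integrable_spectralMeasure_of_norm_le hA (by fun_prop) (C := |z.im|⁻¹)
      (fun t => ?_) χ
    rw [norm_inv]
    refine inv_anti₀ (abs_pos.mpr hz) ?_
    have := Complex.abs_im_le_norm ((t : ℂ) - z)
    simpa using this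
  have hadd : ∀ n χ, Integrable (fun t : ℝ => -(T : ℂ) *
      (((t : ℂ) - (E + (matsubaraFrequency T n : ℂ) * Complex.I))⁻¹ +
        ((t : ℂ) - (E + ((-matsubaraFrequency T n : ℝ) : ℂ) * Complex.I))⁻¹))
      ((hamiltonian K hK v).spectralMeasure hA χ) := fun n χ =>
    ((hint (hz1 n) χ).add (hint (hz2 n) χ)).const_mul _
  unfold functionKernel matsubaraSum greenFunction
  rw [LinearPMap.borelForm_add hA (fun χ => integrable_const _) (fun χ => integrable_finsetSum _
    fun n _ => hadd n χ),
    LinearPMap.borelForm_const_mul, LinearPMap.borelForm_one, LinearPMap.borelForm_sum hA _ hadd]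
  congr 1
  refine Finset.sum_congr rfl fun n _ => ?_
  rw [LinearPMap.borelForm_const_mul, LinearPMap.borelForm_add hA (hint (hz1 n)) (hint (hz2 n)),
    LinearPMap.borelForm_inv_sub hA (hz1 n), LinearPMap.borelForm_inv_sub hA (hz2 n)]

theorem norm_functionKernel_le (v : Site d → ℝ) {f : ℝ → ℂ} {C : ℝ} (hC : ∀ t, ‖f t‖ ≤ C)
    (x y : Site d) : ‖functionKernel K hK v f x y‖ ≤ 2 * C := by
  have h := LinearPMap.norm_borelForm_le (isSelfAdjoint_hamiltonian hK v) hC (siteKet x) (siteKet y)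
  rw [norm_siteKet, norm_siteKet] at h
  exact h.trans (by linarith)

theorem measurable_matsubaraSum (T E : ℝ) (N : ℕ) : Measurable (matsubaraSum T E N) := by
  unfold matsubaraSum
  fun_prop

theorem measurable_fermiDistribution (T : ℝ) : Measurable (fermiDistribution T) := by
  unfold fermiDistribution
  fun_prop

theorem norm_fermiDistribution_le (T u : ℝ) : ‖(fermiDistribution T u : ℂ)‖ ≤ 1 := by
  rw [Complex.norm_real, Real.norm_eq_abs, abs_of_nonneg (fermiDistribution_nonneg T u)]
  exact fermiDistribution_le_one T u

theorem tendsto_functionKernel_matsubaraSum (v : Site d → ℝ) {T : ℝ} (hT : 0 < T) (E : ℝ)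
    (x y : Site d) : Tendsto (fun N => functionKernel K hK v (matsubaraSum T E N) x y) atTop
      (𝓝 (fermiKernel K hK v T E x y)) :=
  LinearPMap.tendsto_borelForm (isSelfAdjoint_hamiltonian hK v) (measurable_matsubaraSum T E)
    (norm_matsubaraSum_le hT E) (tendsto_matsubaraSum hT E) _ _

/-- The spectral projection on `(-∞, E]` as a limit of Fermi functions, where half of the
projection on `{E}` is supplied by the resolvent. -/
theorem tendsto_fermiProjectionKernel (v : Site d → ℝ) (E : ℝ) (x y : Site d) :
    Tendsto (fun n : ℕ => fermiKernel K hK v (1 / ((n : ℝ) + 1)) E x y +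
      2⁻¹ * (-((1 / ((n : ℝ) + 1) : ℝ) : ℂ) * Complex.I) *
        greenFunction K hK v (E + ((1 / ((n : ℝ) + 1) : ℝ) : ℂ) * Complex.I) x y) atTop
      (𝓝 (fermiProjectionKernel K hK v E x y)) := by
  have hA := isSelfAdjoint_hamiltonian hK v
  have hη : ∀ n : ℕ, (0 : ℝ) < 1 / ((n : ℝ) + 1) := fun n => by positivity
  have hz : ∀ n : ℕ, ((E : ℂ) + ((1 / ((n : ℝ) + 1) : ℝ) : ℂ) * Complex.I).im ≠ 0 := fun n => by
    rw [im_ofReal_add_mul_I]; exact (hη n).ne'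
  have hinv : ∀ (n : ℕ) (t : ℝ), ‖2⁻¹ * (-((1 / ((n : ℝ) + 1) : ℝ) : ℂ) * Complex.I) *
      ((t : ℂ) - (E + ((1 / ((n : ℝ) + 1) : ℝ) : ℂ) * Complex.I))⁻¹‖ ≤ 1 := by
    intro n t
    set η : ℝ := 1 / ((n : ℝ) + 1)
    have h1 : η ≤ ‖(t : ℂ) - (E + (η : ℂ) * Complex.I)‖ := by
      have := Complex.abs_im_le_norm ((t : ℂ) - (E + (η : ℂ) * Complex.I))
      rwa [Complex.sub_im, Complex.ofReal_im, im_ofReal_add_mul_I, zero_sub, abs_neg,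
        abs_of_pos (hη n)] at this
    rw [norm_mul, norm_mul, norm_mul, norm_neg, Complex.norm_real, Complex.norm_I, norm_inv,
      norm_inv, Real.norm_eq_abs, abs_of_pos (hη n), mul_one, ← div_eq_mul_inv]
    refine div_le_one_of_le₀ ?_ (norm_nonneg _)
    refine le_trans ?_ h1
    have : ‖(2 : ℂ)‖⁻¹ = 1 / 2 := by simp
    rw [this]
    linarith [hη n]
  have hmeas : ∀ n : ℕ, Measurable fun t : ℝ =>
      2⁻¹ * (-((1 / ((n : ℝ) + 1) : ℝ) : ℂ) * Complex.I) *
      ((t : ℂ) - (E + ((1 / ((n : ℝ) + 1) : ℝ) : ℂ) * Complex.I))⁻¹ := fun n => by fun_prop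
  have hmeas' : ∀ n : ℕ, Measurable fun t : ℝ =>
      (fermiDistribution (1 / ((n : ℝ) + 1)) (t - E) : ℂ) := fun n =>
    Complex.measurable_ofReal.comp ((measurable_fermiDistribution _).comp (measurable_id.sub_const E))
  have h := LinearPMap.tendsto_borelForm (l := atTop) hA (C := 2)
    (F := fun (n : ℕ) (t : ℝ) => (fermiDistribution (1 / ((n : ℝ) + 1)) (t - E) : ℂ) +
      2⁻¹ * (-((1 / ((n : ℝ) + 1) : ℝ) : ℂ) * Complex.I) *
      ((t : ℂ) - (E + ((1 / ((n : ℝ) + 1) : ℝ) : ℂ) * Complex.I))⁻¹)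
    (f := Set.indicator (Set.Iic E) 1)
    (fun n => (hmeas' n).add (hmeas n))
    (fun n t => (norm_add_le _ _).trans
      (by linarith [norm_fermiDistribution_le (1 / ((n : ℝ) + 1)) (t - E), hinv n t]))
    (fun t => ?_) (siteKet x) (siteKet y)
  · refine h.congr fun n => ?_
    rw [LinearPMap.borelForm_add hA
      (LinearPMap.integrable_spectralMeasure_of_norm_le hA (hmeas' n)
        (fun t => norm_fermiDistribution_le _ _))
      (LinearPMap.integrable_spectralMeasure_of_norm_le hA (hmeas n) (hinv n)),
      LinearPMap.borelForm_const_mul, LinearPMap.borelForm_inv_sub hA (hz n)]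
    rfl
  · have h1 := (Complex.continuous_ofReal.tendsto _).comp (tendsto_fermiDistribution_zero (t - E))
    have h0 : Tendsto (fun n : ℕ => ((1 / ((n : ℝ) + 1) : ℝ) : ℂ)) atTop (𝓝 0) := by
      have := (Complex.continuous_ofReal.tendsto 0).comp
        (tendsto_one_div_add_atTop_nhds_zero_nat (𝕜 := ℝ))
      simpa only [Function.comp_def, Complex.ofReal_zero] using this
    have h2 : Tendsto (fun n : ℕ => 2⁻¹ * (-((1 / ((n : ℝ) + 1) : ℝ) : ℂ) * Complex.I) *
        ((t : ℂ) - (E + ((1 / ((n : ℝ) + 1) : ℝ) : ℂ) * Complex.I))⁻¹) atTop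
        (𝓝 (2⁻¹ * ({0} : Set ℝ).indicator 1 (t - E))) := by
      -- At `t = E` the correction equals `1/2` for every `n`, since `-iη · (-iη)⁻¹ = 1`; elsewhere
      -- it is `O(η)`.
      rcases eq_or_ne t E with rfl | hne
      · refine tendsto_const_nhds.congr fun n => ?_
        have h3 : ((1 / ((n : ℝ) + 1) : ℝ) : ℂ) ≠ 0 := by exact_mod_cast (hη n).ne'
        rw [sub_self, Set.indicator_of_mem (Set.mem_singleton (0 : ℝ)), sub_add_cancel_left, mul_assoc, neg_mul,
          mul_inv_cancel₀ (neg_ne_zero.mpr (mul_ne_zero h3 Complex.I_ne_zero))]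
        rfl
      · have hte : (t : ℂ) - E ≠ 0 := by
          rw [sub_ne_zero]; exact_mod_cast hne
        have h3 := ((((h0.neg.mul_const Complex.I).const_mul 2⁻¹)).mul
          ((((h0.mul_const Complex.I).const_add (E : ℂ)).const_sub (t : ℂ)).inv₀ (by simpa using hte)))
        rw [Set.indicator_of_notMem (by simpa [sub_eq_zero] using hne), mul_zero]
        simpa using h3
    have h3 := h1.add h2
    have hval : Set.indicator (Set.Iic E) (1 : ℝ → ℂ) t =
        (((Set.Iio 0).indicator 1 (t - E) + 2⁻¹ * ({0} : Set ℝ).indicator 1 (t - E) : ℝ) : ℂ) +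
          2⁻¹ * ({0} : Set ℝ).indicator 1 (t - E) := by
      rcases lt_trichotomy t E with h | rfl | h
      · simp [h.le, h, sub_eq_zero, h.ne]
      · norm_num
      · simp [h, h.le, sub_eq_zero, h.ne']
    rw [hval]
    exact h3

end Expectation

/-! ### From fractional moments to the decay of the Fermi kernels. -/

section FractionalMoments

open MeasureTheory Filter Topology

variable {d : ℕ} {Ω : Type*} [MeasurableSpace Ω] (P : Measure Ω) [IsProbabilityMeasure P]
  {K : Site d → Site d → ℂ} (hK : IsShortRangeHopping K) {v : Site d → Ω → ℝ}

theorem integrable_norm_greenFunction_rpow (hv : ∀ x, Measurable (v x)) {z : ℂ} (hz : z.im ≠ 0)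
    {s : ℝ} (hs : 0 ≤ s) (x y : Site d) :
    Integrable (fun ω => ‖greenFunction K hK (fun a => v a ω) z x y‖ ^ s) P := by
  refine Integrable.of_bound
    ((measurable_greenFunction hK hv hz x y).norm.pow_const s).aestronglyMeasurable (|z.im|⁻¹ ^ s)
    (ae_of_all _ fun ω => ?_)
  rw [Real.norm_eq_abs, abs_of_nonneg (by positivity)]
  exact Real.rpow_le_rpow (norm_nonneg _) (norm_greenFunction_le hK _ hz x y) hs

theorem integrable_norm_greenFunction (hv : ∀ x, Measurable (v x)) {z : ℂ} (hz : z.im ≠ 0)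
    (x y : Site d) :
    Integrable (fun ω => ‖greenFunction K hK (fun a => v a ω) z x y‖) P := by
  simpa using integrable_norm_greenFunction_rpow P hK hv hz zero_le_one x y

/-- The first moment of the Green function is controlled by a fractional moment, at the price of a
negative power of `|Im z|`. -/
theorem integral_norm_greenFunction_le (hv : ∀ x, Measurable (v x)) {z : ℂ} (hz : z.im ≠ 0)
    {s : ℝ} (hs : 0 < s) (hs1 : s < 1) (x y : Site d) :
    ∫ ω, ‖greenFunction K hK (fun a => v a ω) z x y‖ ∂P ≤
      |z.im| ^ (s - 1) * ∫ ω, ‖greenFunction K hK (fun a => v a ω) z x y‖ ^ s ∂P := by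
  rw [← integral_const_mul]
  refine integral_mono (integrable_norm_greenFunction P hK hv hz x y)
    ((integrable_norm_greenFunction_rpow P hK hv hz hs.le x y).const_mul _) fun ω => ?_
  have hpos := abs_pos.mpr hz
  set g := ‖greenFunction K hK (fun a => v a ω) z x y‖ with hg
  have hg0 : 0 ≤ g := norm_nonneg _
  have hle : g ≤ |z.im|⁻¹ := norm_greenFunction_le hK _ hz x y
  change g ≤ |z.im| ^ (s - 1) * g ^ s
  rcases hg0.eq_or_lt with h0 | h0
  · rw [← h0, Real.zero_rpow hs.ne', mul_zero]
  · have h1 : g ^ (1 - s) ≤ |z.im| ^ (s - 1) := by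
      calc g ^ (1 - s) ≤ (|z.im|⁻¹) ^ (1 - s) := Real.rpow_le_rpow hg0 hle (by linarith)
        _ = |z.im| ^ (s - 1) := by
          rw [Real.inv_rpow hpos.le, ← Real.rpow_neg hpos.le, neg_sub]
    calc g = g ^ (1 - s) * g ^ s := by
          rw [← Real.rpow_add h0, sub_add_cancel, Real.rpow_one]
      _ ≤ _ := by gcongr

/-- The fractional-moment bound at an energy `E`. -/
def FractionalMomentBound (v : Site d → Ω → ℝ) (E s C μ : ℝ) : Prop :=
  ∀ η : ℝ, η ≠ 0 → ∀ x y : Site d,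
    ∫ ω, ‖greenFunction K hK (fun a => v a ω) (E + η * Complex.I) x y‖ ^ s ∂P
      ≤ C ^ s * Real.exp (-(s * μ * latticeDist x y))

variable {P hK}

/-- For small `|η|` the fractional moment gives `|η|^(s-1)`; for large `|η|` the second-order
Combes-Thomas bound gives `η^(-2)`. The decay rate is the smaller of the two. -/
theorem FractionalMomentBound.exists_integral_norm_le {E s C μ : ℝ}
    (h : FractionalMomentBound P hK v E s C μ) (hv : ∀ x, Measurable (v x))
    (hs : 0 < s) (hs1 : s < 1) (hC : 0 < C) (hμ : 0 < μ) :
    ∃ A : ℝ, 0 ≤ A ∧ ∃ m : ℝ, 0 < m ∧ ∀ η : ℝ, η ≠ 0 → ∀ x y : Site d, x ≠ y →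
      ∫ ω, ‖greenFunction K hK (fun a => v a ω) (E + η * Complex.I) x y‖ ∂P ≤
        A * Real.exp (-(m * latticeDist x y)) * fractionalWeight s |η| := by
  obtain ⟨ν, hν, B, hB⟩ := hK.shortRange
  have hB0 : 0 ≤ B := (tsum_nonneg fun _ => by positivity).trans (hB 0).2
  have hsμ : 0 < s * μ := mul_pos hs hμ
  -- The regimes meet at `|η| = 2B + 1`: beyond it `(|η| - B)⁻¹ ≤ 2/|η|`, and `|η| ≥ 1` lets
  -- `η^(-2)` be bounded by four times the weight, whence `8B`.
  refine ⟨C ^ s * (1 + (2 * B + 1)) ^ 2 + 8 * B, by positivity, min (s * μ) ν, lt_min hsμ hν,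
    fun η hη x y hxy => ?_⟩
  set D := latticeDist x y with hD
  have hD0 : 0 ≤ D := latticeDist_nonneg x y
  have him : ((E : ℂ) + (η : ℂ) * Complex.I).im = η := im_ofReal_add_mul_I E η
  have hz : ((E : ℂ) + (η : ℂ) * Complex.I).im ≠ 0 := by rwa [him]
  have hη0 := abs_pos.mpr hη
  have hw := fractionalWeight_nonneg (s := s) hη0.le
  have hexp1 : Real.exp (-(s * μ * D)) ≤ Real.exp (-(min (s * μ) ν * D)) := by
    gcongr; exact min_le_left _ _
  have hexp2 : Real.exp (-(ν * D)) ≤ Real.exp (-(min (s * μ) ν * D)) := by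
    gcongr; exact min_le_right _ _
  rcases le_total |η| (2 * B + 1) with hsmall | hlarge
  · have h1 := integral_norm_greenFunction_le P hK hv hz hs hs1 x y
    rw [him] at h1
    calc _ ≤ |η| ^ (s - 1) *
          ∫ ω, ‖greenFunction K hK (fun a => v a ω) (E + η * Complex.I) x y‖ ^ s ∂P := h1
      _ ≤ ((1 + (2 * B + 1)) ^ 2 * fractionalWeight s |η|) *
          (C ^ s * Real.exp (-(min (s * μ) ν * D))) := by
        refine mul_le_mul (rpow_le_fractionalWeight hs1 hη0 hsmall) ((h η hη x y).trans ?_)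
          (integral_nonneg fun ω => by positivity) (by positivity)
        gcongr
      _ = (C ^ s * (1 + (2 * B + 1)) ^ 2) * Real.exp (-(min (s * μ) ν * D)) *
          fractionalWeight s |η| := by ring
      _ ≤ _ := by
        gcongr
        linarith
  · have h1 : ∀ ω, ‖greenFunction K hK (fun a => v a ω) (E + η * Complex.I) x y‖ ≤
        8 * B * fractionalWeight s |η| * Real.exp (-(min (s * μ) ν * D)) := by
      intro ω
      have h2 := norm_greenFunction_le_exp_of_ne hK (fun a => v a ω) hν hB
        (z := E + η * Complex.I) (by rw [him]; linarith) hxy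
      rw [him] at h2
      have h3 : |η|⁻¹ * (B * (|η| - B)⁻¹) ≤ 8 * B * fractionalWeight s |η| := by
        have h4 : (|η| - B)⁻¹ ≤ 2 * |η|⁻¹ := by
          rw [← one_div, ← div_eq_mul_inv, div_le_div_iff₀ (by linarith) hη0]
          linarith
        have h5 := inv_sq_le_fractionalWeight (s := s) (η := |η|) hs1 (by linarith)
        calc _ ≤ |η|⁻¹ * (B * (2 * |η|⁻¹)) := by gcongr
          _ = 2 * B * (|η| ^ 2)⁻¹ := by rw [← inv_pow]; ring
          _ ≤ 2 * B * (4 * fractionalWeight s |η|) := by gcongr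
          _ = _ := by ring
      exact h2.trans (mul_le_mul h3 hexp2 (Real.exp_pos _).le (by positivity))
    calc _ ≤ ∫ _, 8 * B * fractionalWeight s |η| * Real.exp (-(min (s * μ) ν * D)) ∂P :=
          integral_mono (integrable_norm_greenFunction P hK hv hz x y) (integrable_const _) h1
      _ = 8 * B * Real.exp (-(min (s * μ) ν * D)) * fractionalWeight s |η| := by
          rw [integral_const, probReal_univ, one_smul]; ring
      _ ≤ _ := by
        gcongr
        linarith [show 0 ≤ C ^ s * (1 + (2 * B + 1)) ^ 2 by positivity]

theorem measurable_functionKernel_matsubaraSum (hv : ∀ x, Measurable (v x)) {T : ℝ} (hT : 0 < T)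
    (E : ℝ) (N : ℕ) (x y : Site d) :
    Measurable fun ω => functionKernel K hK (fun a => v a ω) (matsubaraSum T E N) x y := by
  simp only [functionKernel_matsubaraSum hK _ hT]
  have hη := fun n => (matsubaraFrequency_pos hT n).ne'
  refine measurable_const.add (Finset.measurable_sum _ fun n _ => Measurable.const_mul
    (Measurable.add (measurable_greenFunction hK hv ?_ x y)
      (measurable_greenFunction hK hv ?_ x y)) _)
  · rw [im_ofReal_add_mul_I]; exact hη n
  · rw [im_ofReal_add_mul_I]; exact neg_ne_zero.mpr (hη n)

theorem measurable_fermiKernel (hv : ∀ x, Measurable (v x)) {T : ℝ} (hT : 0 < T)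
    (E : ℝ) (x y : Site d) :
    Measurable fun ω => fermiKernel K hK (fun a => v a ω) T E x y :=
  measurable_of_tendsto_metrizable
    (fun N => measurable_functionKernel_matsubaraSum hv hT E N x y)
    (tendsto_pi_nhds.mpr fun _ => tendsto_functionKernel_matsubaraSum hK _ hT E x y)

theorem norm_fermiKernel_le (v : Site d → ℝ) (T E : ℝ) (x y : Site d) :
    ‖fermiKernel K hK v T E x y‖ ≤ 2 := by
  have h := norm_functionKernel_le hK v (fun t => norm_fermiDistribution_le T (t - E)) x y
  rwa [mul_one] at h

theorem integrable_fermiKernel (hv : ∀ x, Measurable (v x)) {T : ℝ} (hT : 0 < T)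
    (E : ℝ) (x y : Site d) :
    Integrable (fun ω => fermiKernel K hK (fun a => v a ω) T E x y) P :=
  Integrable.of_bound (measurable_fermiKernel hv hT E x y).aestronglyMeasurable 2
    (ae_of_all _ fun _ => norm_fermiKernel_le _ _ _ _ _)

/-- The triangle inequality, term by term, is affordable in expectation: what remains is `T` times a
sum of weights, bounded uniformly in `T` and `N`. Off the diagonal the constant `1/2` of the
expansion drops out. -/
theorem integral_norm_functionKernel_matsubaraSum_le (hv : ∀ x, Measurable (v x))
    {E s A m T : ℝ} (hs : 0 < s) (hs1 : s < 1) (hA : 0 ≤ A) {x y : Site d} (hxy : x ≠ y)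
    (hG : ∀ η : ℝ, η ≠ 0 →
      ∫ ω, ‖greenFunction K hK (fun a => v a ω) (E + η * Complex.I) x y‖ ∂P ≤
        A * Real.exp (-(m * latticeDist x y)) * fractionalWeight s |η|) (hT : 0 < T) (N : ℕ) :
    ∫ ω, ‖functionKernel K hK (fun a => v a ω) (matsubaraSum T E N) x y‖ ∂P ≤
      2 * A * (Real.pi * s)⁻¹ * Real.exp (-(m * latticeDist x y)) := by
  set G : ℝ → Ω → ℝ := fun η ω =>
    ‖greenFunction K hK (fun a => v a ω) (E + η * Complex.I) x y‖ with hGdef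
  have hη := fun n => matsubaraFrequency_pos hT n
  have hint : ∀ η : ℝ, η ≠ 0 → Integrable (G η) P := fun η h =>
    integrable_norm_greenFunction P hK hv (by rwa [im_ofReal_add_mul_I]) x y
  have hint2 : ∀ n, Integrable (fun ω => T * (G (matsubaraFrequency T n) ω +
      G (-matsubaraFrequency T n) ω)) P := fun n =>
    ((hint _ (hη n).ne').add (hint _ (neg_ne_zero.mpr (hη n).ne'))).const_mul T
  have hpt : ∀ ω, ‖functionKernel K hK (fun a => v a ω) (matsubaraSum T E N) x y‖ ≤
      ∑ n ∈ Finset.range N, T * (G (matsubaraFrequency T n) ω +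
        G (-matsubaraFrequency T n) ω) := by
    intro ω
    rw [functionKernel_matsubaraSum hK _ hT, inner_siteKet, siteKet_apply_ne hxy, mul_zero,
      zero_add]
    refine (norm_sum_le _ _).trans (Finset.sum_le_sum fun n _ => ?_)
    rw [norm_mul, norm_neg, Complex.norm_real, Real.norm_eq_abs, abs_of_pos hT]
    gcongr
    exact norm_add_le _ _
  have hkint : Integrable (fun ω =>
      ‖functionKernel K hK (fun a => v a ω) (matsubaraSum T E N) x y‖) P := by
    refine Integrable.of_bound
      (measurable_functionKernel_matsubaraSum hv hT E N x y).norm.aestronglyMeasurable (2 * 1)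
      (ae_of_all _ fun ω => ?_)
    rw [norm_norm]
    exact norm_functionKernel_le hK _ (norm_matsubaraSum_le hT E N) x y
  set e := Real.exp (-(m * latticeDist x y)) with he
  have he0 : 0 < e := Real.exp_pos _
  calc _ ≤ ∫ ω, ∑ n ∈ Finset.range N, T * (G (matsubaraFrequency T n) ω +
        G (-matsubaraFrequency T n) ω) ∂P :=
        integral_mono hkint (integrable_finsetSum _ fun n _ => hint2 n) hpt
    _ = ∑ n ∈ Finset.range N, T * (∫ ω, G (matsubaraFrequency T n) ω ∂P +
        ∫ ω, G (-matsubaraFrequency T n) ω ∂P) := by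
        rw [integral_finsetSum _ fun n _ => hint2 n]
        refine Finset.sum_congr rfl fun n _ => ?_
        rw [integral_const_mul, integral_add (hint _ (hη n).ne')
          (hint _ (neg_ne_zero.mpr (hη n).ne'))]
    _ ≤ ∑ n ∈ Finset.range N, T * (A * e * fractionalWeight s (matsubaraFrequency T n) +
        A * e * fractionalWeight s (matsubaraFrequency T n)) := by
        refine Finset.sum_le_sum fun n _ => ?_
        have h1 := hG _ (hη n).ne'
        have h2 := hG _ (neg_ne_zero.mpr (hη n).ne')
        rw [abs_neg] at h2
        rw [abs_of_pos (hη n)] at h1 h2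
        gcongr
    _ = 2 * A * e * (T * ∑ n ∈ Finset.range N, fractionalWeight s (matsubaraFrequency T n)) := by
        rw [Finset.mul_sum, Finset.mul_sum]
        refine Finset.sum_congr rfl fun n _ => by ring
    _ ≤ 2 * A * e * (Real.pi * s)⁻¹ := by
        gcongr
        exact sum_fractionalWeight_matsubara_le hs hs1 hT N
    _ = _ := by ring

theorem FractionalMomentBound.exists_fermiKernel_bound {E s C μ : ℝ}
    (h : FractionalMomentBound P hK v E s C μ) (hv : ∀ x, Measurable (v x))
    (hs : 0 < s) (hs1 : s < 1) (hC : 0 < C) (hμ : 0 < μ) :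
    ∃ A : ℝ, 0 < A ∧ ∃ m : ℝ, 0 < m ∧ ∀ T : ℝ, 0 < T → ∀ x y : Site d,
      ∫ ω, ‖fermiKernel K hK (fun a => v a ω) T E x y‖ ∂P ≤
        A * Real.exp (-(m * latticeDist x y)) := by
  obtain ⟨A, hA, m, hm, hG⟩ := h.exists_integral_norm_le hv hs hs1 hC hμ
  have hpi := Real.pi_pos
  -- The added `2` serves the diagonal, where the trivial bound on the kernel is enough.
  refine ⟨2 * A * (Real.pi * s)⁻¹ + 2, by positivity, m, hm, fun T hT x y => ?_⟩
  by_cases hxy : x = y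
  · subst hxy
    rw [latticeDist_self, mul_zero, neg_zero, Real.exp_zero, mul_one]
    calc _ ≤ ∫ _, (2 : ℝ) ∂P := integral_mono (integrable_fermiKernel hv hT E x x).norm
          (integrable_const _) fun _ => norm_fermiKernel_le _ _ _ _ _
      _ = 2 := by rw [integral_const, probReal_univ, one_smul]
      _ ≤ _ := by linarith [show 0 ≤ 2 * A * (Real.pi * s)⁻¹ by positivity]
  · have h1 := (integrable_and_integral_norm_le_of_tendsto (P := P)
      (fun N => measurable_functionKernel_matsubaraSum (hK := hK) hv hT E N x y)
      (fun N ω => norm_functionKernel_le hK _ (norm_matsubaraSum_le hT E N) x y)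
      (fun ω => tendsto_functionKernel_matsubaraSum hK _ hT E x y)
      (integral_norm_functionKernel_matsubaraSum_le hv hs hs1 hA hxy
        (fun η hη => hG η hη x y hxy) hT) tendsto_const_nhds).2
    refine h1.trans ?_
    gcongr
    linarith

/-- The resolvent that supplies half of the atom at `E` costs nothing in the limit: the
fractional-moment bound at `η = 1/(n+1)` makes its contribution vanish, so the bound `b` survives
unchanged. -/
theorem FractionalMomentBound.integral_norm_fermiProjectionKernel_le {E s C μ : ℝ}
    (h : FractionalMomentBound P hK v E s C μ) (hv : ∀ x, Measurable (v x))
    (hs : 0 < s) (hs1 : s < 1) {x y : Site d} {b : ℝ}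
    (hb : ∀ T : ℝ, 0 < T → ∫ ω, ‖fermiKernel K hK (fun a => v a ω) T E x y‖ ∂P ≤ b) :
    Integrable (fun ω => fermiProjectionKernel K hK (fun a => v a ω) E x y) P ∧
      ∫ ω, ‖fermiProjectionKernel K hK (fun a => v a ω) E x y‖ ∂P ≤ b := by
  have hη : ∀ n : ℕ, (0 : ℝ) < 1 / ((n : ℝ) + 1) := fun n => by positivity
  have hz : ∀ n : ℕ, ((E : ℂ) + ((1 / ((n : ℝ) + 1) : ℝ) : ℂ) * Complex.I).im ≠ 0 := fun n => by
    rw [im_ofReal_add_mul_I]; exact (hη n).ne'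
  have hnorm : ∀ (n : ℕ) (g : ℂ),
      ‖2⁻¹ * (-((1 / ((n : ℝ) + 1) : ℝ) : ℂ) * Complex.I) * g‖ =
        2⁻¹ * (1 / ((n : ℝ) + 1)) * ‖g‖ := fun n g => by
    rw [norm_mul, norm_mul, norm_mul, norm_neg, Complex.norm_real, Complex.norm_I, norm_inv,
      Real.norm_eq_abs, abs_of_pos (hη n), mul_one, Complex.norm_ofNat]
  set b' := C ^ s * Real.exp (-(s * μ * latticeDist x y)) with hb'
  refine integrable_and_integral_norm_le_of_tendsto (M := 3)
    -- The power `s` is `η · η^(s-1)`: the prefactor of the resolvent times the loss in its first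
    -- moment.
    (c := fun n : ℕ => b + 2⁻¹ * (1 / ((n : ℝ) + 1)) ^ s * b')
    (fun n => (measurable_fermiKernel hv (hη n) E x y).add
      ((measurable_greenFunction hK hv (hz n) x y).const_mul _))
    (fun n ω => ?_) (fun ω => tendsto_fermiProjectionKernel hK _ E x y) (fun n => ?_) ?_
  · refine (norm_add_le _ _).trans ?_
    have h1 := norm_fermiKernel_le (hK := hK) (fun a => v a ω) (1 / ((n : ℝ) + 1)) E x y
    have h2 := norm_greenFunction_le hK (fun a => v a ω) (hz n) x y
    rw [im_ofReal_add_mul_I, abs_of_pos (hη n)] at h2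
    rw [hnorm]
    have h3 : 2⁻¹ * (1 / ((n : ℝ) + 1)) * ‖greenFunction K hK (fun a => v a ω)
        (E + ((1 / ((n : ℝ) + 1) : ℝ) : ℂ) * Complex.I) x y‖ ≤
        2⁻¹ * (1 / ((n : ℝ) + 1)) * (1 / ((n : ℝ) + 1))⁻¹ := by gcongr
    rw [mul_inv_cancel_right₀ (hη n).ne'] at h3
    linarith
  · have hgi := integrable_norm_greenFunction P hK hv (hz n) x y
    have h1 := integral_norm_greenFunction_le P hK hv (hz n) hs hs1 x y
    rw [im_ofReal_add_mul_I, abs_of_pos (hη n)] at h1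
    have h2 := h _ (hη n).ne' x y
    have hki := (integrable_fermiKernel (P := P) (hK := hK) hv (hη n) E x y)
    calc _ ≤ ∫ ω, (‖fermiKernel K hK (fun a => v a ω) (1 / ((n : ℝ) + 1)) E x y‖ +
          2⁻¹ * (1 / ((n : ℝ) + 1)) * ‖greenFunction K hK (fun a => v a ω)
            (E + ((1 / ((n : ℝ) + 1) : ℝ) : ℂ) * Complex.I) x y‖) ∂P := by
          refine integral_mono_of_nonneg (ae_of_all _ fun _ => norm_nonneg _)
            (hki.norm.add (hgi.const_mul _)) (ae_of_all _ fun ω => ?_)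
          exact (norm_add_le _ _).trans (by rw [hnorm])
      _ = ∫ ω, ‖fermiKernel K hK (fun a => v a ω) (1 / ((n : ℝ) + 1)) E x y‖ ∂P +
          2⁻¹ * (1 / ((n : ℝ) + 1)) * ∫ ω, ‖greenFunction K hK (fun a => v a ω)
            (E + ((1 / ((n : ℝ) + 1) : ℝ) : ℂ) * Complex.I) x y‖ ∂P := by
          rw [integral_add hki.norm (hgi.const_mul _), integral_const_mul]
      _ ≤ b + 2⁻¹ * (1 / ((n : ℝ) + 1)) * ((1 / ((n : ℝ) + 1)) ^ (s - 1) * b') := by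
          refine add_le_add (hb _ (hη n)) (mul_le_mul_of_nonneg_left (h1.trans ?_)
            (by positivity))
          gcongr
      _ = _ := by
          rw [Real.rpow_sub (hη n), Real.rpow_one]
          field_simp
  · have h1 := (tendsto_one_div_add_atTop_nhds_zero_nat (𝕜 := ℝ)).rpow_const (p := s)
      (Or.inr hs.le)
    rw [Real.zero_rpow hs.ne'] at h1
    simpa using ((h1.const_mul 2⁻¹).mul_const b').const_add b

end FractionalMoments

end

theorem theorem2 {d : ℕ} {Ω : Type*} [MeasurableSpace Ω] (P : MeasureTheory.Measure Ω)
    [MeasureTheory.IsProbabilityMeasure P]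
    (K : Site d → Site d → ℂ) (hK : IsShortRangeHopping K)
    (U : Site d → ℝ) (lam : ℝ) (V : Site d → Ω → ℝ) (hV : ∀ x, Measurable (V x)) (E_F : ℝ)
    (hgs : ∃ s : ℝ, 0 < s ∧ s < 1 ∧ ∃ C : ℝ, 0 < C ∧ ∃ μ : ℝ, 0 < μ ∧
      ∀ η : ℝ, η ≠ 0 → ∀ x y : Site d,
        ∫ ω, ‖greenFunction K hK (fun a => U a + lam * V a ω) (E_F + η * Complex.I) x y‖ ^ s ∂P
          ≤ C ^ s * Real.exp (-(s * μ * latticeDist x y))) :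
    ∃ C : ℝ, 0 < C ∧ ∃ ξ : ℝ, 0 < ξ ∧
      (∀ T : ℝ, 0 < T → ∀ x y : Site d,
        MeasureTheory.Integrable (fun ω => fermiKernel K hK (fun a => U a + lam * V a ω) T E_F x y) P ∧
          ∫ ω, ‖fermiKernel K hK (fun a => U a + lam * V a ω) T E_F x y‖ ∂P
            ≤ C * Real.exp (-(latticeDist x y / ξ))) ∧
      (∀ x y : Site d,
        MeasureTheory.Integrable (fun ω => fermiProjectionKernel K hK (fun a => U a + lam * V a ω) E_F x y) P ∧
          ∫ ω, ‖fermiProjectionKernel K hK (fun a => U a + lam * V a ω) E_F x y‖ ∂P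
            ≤ C * Real.exp (-(latticeDist x y / ξ))) := by
  obtain ⟨s, hs, hs1, C, hC, μ, hμ, h⟩ := hgs
  have hv : ∀ a, Measurable fun ω => U a + lam * V a ω := fun a => ((hV a).const_mul lam).const_add _
  have hbound : FractionalMomentBound P hK (fun a ω => U a + lam * V a ω) E_F s C μ := h
  obtain ⟨A, hA, m, hm, hF⟩ := hbound.exists_fermiKernel_bound hv hs hs1 hC hμ
  have hξ : ∀ D : ℝ, D / m⁻¹ = m * D := fun D => by rw [div_inv_eq_mul, mul_comm]
  refine ⟨A, hA, m⁻¹, inv_pos.mpr hm, fun T hT x y => ⟨integrable_fermiKernel hv hT E_F x y, ?_⟩,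
    fun x y => ?_⟩
  · rw [hξ]
    exact hF T hT x y
  · rw [hξ]
    exact hbound.integral_norm_fermiProjectionKernel_le hv hs hs1 fun T hT => hF T hT x y
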